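/- Conventions. A complex orbifold $X$ of dimension $n$ is given by an atlas of uniformising charts $(\tilde U,\Gamma,\varphi)$, where $\tilde U\subset\mathbb C^n$ is a connected open set containing the origin, $\Gamma$ is a finite group acting effectively on $\tilde U$ by biholomorphisms, and $\varphi:\tilde U\to X$ induces a homeomorphism of $\tilde U/\Gamma$ onto an open subset of $X$. An injection $(\tilde U,\Gamma,\varphi)\to(\tilde U',\Gamma',\varphi')$ is a holomorphic embedding $f:\tilde U\to\tilde U'$ with $\varphi'\circ f=\varphi$; the elements of $\Gamma$ are injections of a chart into itself. For $D\subset X$ write $\tilde D=\varphi^{-1}(D\cap\varphi(\tilde U))$. The spaces underlying $N_D\setminus\{0\}$ and $K_D\setminus\{0\}$ are obtained by gluing the spaces $N_{\tilde D}\setminus\{0\}$, respectively $K_{\tilde D}\setminus\{0\}$, of all charts along the maps induced by all injections, where $N_{\tilde D}=T\tilde U|_{\tilde D}/T\tilde D$ is the holomorphic normal bundle and $K_{\tilde D}=\Lambda^{n-1}T^*\tilde D$ the canonical bundle of $\tilde D$. A map of orbifolds $N_D\setminus\{0\}\to K_D\setminus\{0\}$ is a map of these spaces together with lifts $N_{\tilde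 D}\setminus\{0\}\to K_{\tilde D}\setminus\{0\}$ that are compatible with all injections (so each is $\Gamma$-equivariant). It is holomorphic if its lifts are, and it is an unbranched $k$-fold covering map if it is continuous and surjective and each lift is a covering map all of whose fibres have exactly $k$ points. A holomorphic volume form $\Omega$ on $X\setminus D$ is a family of nowhere vanishing holomorphic $n$-forms $\varphi^*\Omega$ on the sets $\tilde U\setminus\tilde D$ that is compatible with all injections. It blows up to order $\alpha$ along $D$ if, for local defining functions $s$ of $\tilde D$ (holomorphic, with zero set $\tilde D$ and $ds\neq0$ along $\tilde D$), $s^\alpha\varphi^*\Omega$ extends to a nowhere vanishing holomorphic form across $\tilde D$. **Corollary 2.3.** Let $X$ be a compact (Hausdorff) Kähler orbifold of complex dimension $n\ge1$ and let $D\subset X$ be a complex suborbifold of codimension one that contains the singular points of $X$ (those with non-trivial isotropy group) and satisfies $-K_X=\alpha[D]$ (an isomorphism of holomorphic line orbibundles) for some integer $\alpha\ge2$. Assume that every point of $D$ lies in $\varphi(\tilde U)$ for some uniformising chart $(\tilde U,\Gamma,\varphi)$ that is adapted, that is, which admits holomorphic coordinates $(z_1,\dots,z_n)$ on $\tilde U$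 such that (i) $\tilde D=\{z_n=0\}$, and (ii) each $\gamma\in\Gamma$ acts in these coordinates as a matrix $\begin{pmatrix}A&\star\\0&b\end{pmatrix}$ with $A\in GL(n-1,\mathbb C)$ and $b^{\alpha-1}=\det A$. Then there is a holomorphic volume form on $X\setminus D$ that blows up to order $\alpha$ along $D$. For every such form $\Omega$ there is an unbranched holomorphic $(\alpha-1)$-fold covering map of orbifolds $$\phi_\Omega:N_D\setminus\{0\}\longrightarrow K_D\setminus\{0\}$$ which, in every adapted uniformising chart $(\tilde U,\Gamma,\varphi)$, for every holomorphic function $s$ on $\tilde U$ with $\tilde D=\{s=0\}$ and $ds\ne0$ along $\tilde D$, and at every $z\in\tilde D$, is given by $$\Bigl(z,\ \lambda\,\frac{\partial}{\partial s}\Bigr)\longmapsto\Bigl(z,\ \lambda^{1-\alpha}\,\bigl((s^\alpha\varphi^*\Omega)\lrcorner\tfrac{\partial}{\partial s}\bigr)\big|_{\tilde D}\Bigr),\qquad\lambda\in\mathbb C^*,$$ where $\frac{\partial}{\partial s}$ is the section of $N_{\tilde D}$ on which $ds|_{\tilde D}$ evaluates to one, and $s^\alpha\varphi^*\Omega$ stands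 for its holomorphic extension to $\tilde U$. The map $\phi_\Omega$ depends only on $\Omega$: it is the only map of orbifolds that is given by this formula in all adapted charts. -/

import Mathlib

open scoped Topology ContDiff

universe u

/-! ### Complex orbifolds -/

/-- The model space `ℂⁿ`. -/
abbrev CSpace (n : ℕ) : Type := Fin n → ℂ

/-- A holomorphic uniformising chart `(Ũ, Γ, φ)` of complex dimension `n` on `X`: `Ũ` is a connected
open subset of `ℂⁿ` containing the origin, `Γ` is a finite group acting effectively on `Ũ` by
biholomorphisms, and `φ : Ũ → X` induces a homeomorphism of `Ũ / Γ` onto an open subset of `X`.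
As the action is effective, `Γ` is given as a finite group of bijections of `Ũ`; each of them is
extended to `ℂⁿ` by the identity outside `Ũ`. The values of `proj` outside `Ũ` play no role. -/
structure OrbChart (X : Type u) [TopologicalSpace X] (n : ℕ) where
  /-- the domain `Ũ` -/
  U : Set (CSpace n)
  isOpen_U : IsOpen U
  isPreconnected_U : IsPreconnected U
  zero_mem : (0 : CSpace n) ∈ U
  /-- the local uniformising group `Γ` -/
  Γ : Subgroup (Equiv.Perm (CSpace n))
  finite_Γ : Finite Γ
  act_mem : ∀ γ ∈ Γ, ∀ z ∈ U, γ z ∈ U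
  act_off : ∀ γ ∈ Γ, ∀ z, z ∉ U → γ z = z
  act_holo : ∀ γ ∈ Γ, DifferentiableOn ℂ (γ : CSpace n → CSpace n) U
  /-- the map `φ` -/
  proj : CSpace n → X
  proj_cont : ContinuousOn proj U
  proj_open : ∀ V, V ⊆ U → IsOpen V → IsOpen (proj '' V)
  proj_eq_iff : ∀ z ∈ U, ∀ w ∈ U, proj z = proj w ↔ ∃ γ ∈ Γ, γ z = w

/-- The open set `φ(Ũ)` of `X`. -/
def OrbChart.range {X : Type u} [TopologicalSpace X] {n : ℕ} (c : OrbChart X n) : Set X :=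
  c.proj '' c.U

/-- `D̃ = φ⁻¹(D ∩ φ(Ũ))`. -/
def OrbChart.pre {X : Type u} [TopologicalSpace X] {n : ℕ} (c : OrbChart X n) (D : Set X) :
    Set (CSpace n) :=
  {z | z ∈ c.U ∧ c.proj z ∈ D}

/-- `f` is an injection `(Ũ, Γ, φ) → (Ũ', Γ', φ')` of charts: a holomorphic embedding
`f : Ũ → Ũ'` (an injective immersion between open sets of the same dimension) with `φ' ∘ f = φ`.
The values of `f` outside `Ũ` play no role. -/
structure IsInjection {X : Type u} [TopologicalSpace X] {n : ℕ} (c d : OrbChart X n)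
    (f : CSpace n → CSpace n) : Prop where
  mapsTo : Set.MapsTo f c.U d.U
  holo : DifferentiableOn ℂ f c.U
  injOn : Set.InjOn f c.U
  immersion : ∀ z ∈ c.U, Function.Injective (fderiv ℂ f z)
  proj_comp : ∀ z ∈ c.U, d.proj (f z) = c.proj z

/-- The elements of the local uniformising group are injections of the chart into itself, so that
everything that is required below for all injections includes invariance (or equivariance) under
the local uniformising groups. -/
theorem OrbChart.isInjection_of_mem {X : Type u} [TopologicalSpace X] {n : ℕ} (c : OrbChart X n)
    {γ : Equiv.Perm (CSpace n)} (hγ : γ ∈ c.Γ) : IsInjection c c γ where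
  mapsTo := fun z hz => c.act_mem γ hγ z hz
  holo := c.act_holo γ hγ
  injOn := γ.injective.injOn
  immersion := by
    intro z hz
    have hd : DifferentiableAt ℂ (γ : CSpace n → CSpace n) z :=
      (c.act_holo γ hγ).differentiableAt (c.isOpen_U.mem_nhds hz)
    have hd' : DifferentiableAt ℂ ((γ⁻¹ : Equiv.Perm (CSpace n)) : CSpace n → CSpace n) (γ z) :=
      (c.act_holo γ⁻¹ (c.Γ.inv_mem hγ)).differentiableAt
        (c.isOpen_U.mem_nhds (c.act_mem γ hγ z hz))
    have hc := (hd'.hasFDerivAt.comp z hd.hasFDerivAt).fderiv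
    have hid : ((γ⁻¹ : Equiv.Perm (CSpace n)) : CSpace n → CSpace n) ∘ γ = id := by
      funext w
      simp
    rw [hid, fderiv_id] at hc
    intro v w hvw
    have hv := congrArg (fun L : CSpace n →L[ℂ] CSpace n => L v) hc
    have hw := congrArg (fun L : CSpace n →L[ℂ] CSpace n => L w) hc
    simp only [ContinuousLinearMap.comp_apply, ContinuousLinearMap.id_apply] at hv hw
    rw [hv, hw, hvw]
  proj_comp := fun z hz =>
    ((c.proj_eq_iff z hz (γ z) (c.act_mem γ hγ z hz)).2 ⟨γ, hγ, rfl⟩).symm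

/-- A family of charts is an orbifold atlas of `X`. -/
structure IsOrbAtlas {X : Type u} [TopologicalSpace X] {n : ℕ} (A : Set (OrbChart X n)) :
    Prop where
  cover : ∀ x : X, ∃ c ∈ A, x ∈ c.range
  compat : ∀ c ∈ A, ∀ d ∈ A, ∀ x ∈ c.range ∩ d.range,
    ∃ e ∈ A, x ∈ e.range ∧ (∃ f, IsInjection e c f) ∧ ∃ g, IsInjection e d g

/-- A complex orbifold of dimension `n` with underlying space `X`, given by an orbifold atlas. The
atlas may be, but is not required to be, the maximal one. -/
structure ComplexOrbifold (X : Type u) [TopologicalSpace X] (n : ℕ) where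
  atlas : Set (OrbChart X n)
  isAtlas : IsOrbAtlas atlas

section Orbifold

variable {X : Type u} [TopologicalSpace X] {n : ℕ}

/-- `Sing(X)`: the points with non-trivial isotropy group. -/
def ComplexOrbifold.singularSet (O : ComplexOrbifold X n) : Set X :=
  {x | ∃ c ∈ O.atlas, ∃ z ∈ c.U, c.proj z = x ∧ ∃ γ ∈ c.Γ, γ ≠ 1 ∧ γ z = z}

/-- The orbifold admits a Kähler form: a closed positive real `(1,1)`-form on each uniformising
chart, preserved by all injections, in particular by the local uniformising groups. -/
def ComplexOrbifold.IsKahler (O : ComplexOrbifold X n) : Prop :=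
  ∃ κ : OrbChart X n → CSpace n → (CSpace n) [⋀^Fin 2]→L[ℝ] ℝ,
    (∀ c ∈ O.atlas, ContDiffOn ℝ ∞ (κ c) c.U ∧
      ∀ z ∈ c.U, extDeriv (κ c) z = 0 ∧
        (∀ v w : CSpace n, κ c z ![Complex.I • v, Complex.I • w] = κ c z ![v, w]) ∧
        ∀ v : CSpace n, v ≠ 0 → 0 < κ c z ![v, Complex.I • v]) ∧
    ∀ c ∈ O.atlas, ∀ d ∈ O.atlas, ∀ f, IsInjection c d f → ∀ z ∈ c.U,
      (κ d (f z)).compContinuousLinearMap ((fderiv ℂ f z).restrictScalars ℝ) = κ c z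

/-! ### Complex suborbifolds of codimension one -/

/-- `s` is holomorphic on `V`, has zero set `S ∩ V` there, and vanishes to order one along it. -/
structure IsDefiningFunctionOn (S V : Set (CSpace n)) (s : CSpace n → ℂ) : Prop where
  holo : DifferentiableOn ℂ s V
  zero_iff : ∀ z ∈ V, s z = 0 ↔ z ∈ S
  deriv_ne : ∀ z ∈ V, z ∈ S → fderiv ℂ s z ≠ 0

/-- `S` is a complex submanifold of codimension one. -/
def IsComplexHypersurface (S : Set (CSpace n)) : Prop :=
  ∀ z ∈ S, ∃ V, IsOpen V ∧ z ∈ V ∧ ∃ s, IsDefiningFunctionOn S V s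

/-- `D` is a complex suborbifold of codimension one: around each of its points there is a
uniformising chart in which the preimage of `D` is a complex submanifold of codimension one. -/
def ComplexOrbifold.IsSuborbifoldCodimOne (O : ComplexOrbifold X n) (D : Set X) : Prop :=
  ∀ p ∈ D, ∃ c ∈ O.atlas, p ∈ c.range ∧ IsComplexHypersurface (c.pre D)

/-- For an injection `f` from one chart to another, with defining functions `s`, `t` of `D` in the
two charts, `u` is the quotient `s / (t ∘ f)`: the transition function of the line orbibundle `[D]`
along `f`. -/
def IsDivisorTransition (c : OrbChart X n) (f : CSpace n → CSpace n) (s t : CSpace n → ℂ)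
    (u : CSpace n → ℂ) : Prop :=
  DifferentiableOn ℂ u c.U ∧ ∀ z ∈ c.U, s z = u z * t (f z)

/-- `-K_X = α[D]`: the line orbibundles `-K_X` and `α[D]` are isomorphic. On an atlas of charts `c`
in which `D` has defining functions `s c`, both bundles are trivial over each chart. The transition
function of `K_X` along an injection `f` is `det (df)`, that of `[D]` is `s c / (s d ∘ f)`. An
isomorphism from `-K_X` to `α[D]` is a family of nowhere vanishing holomorphic functions `θ c` that
intertwines the two systems of transition functions. -/
def ComplexOrbifold.AnticanonicalEq (O : ComplexOrbifold X n) (D : Set X) (α : ℕ) : Prop :=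
  ∃ A ⊆ O.atlas, IsOrbAtlas A ∧ ∃ s : OrbChart X n → CSpace n → ℂ,
    (∀ c ∈ A, IsDefiningFunctionOn (c.pre D) c.U (s c)) ∧
    ∃ θ : OrbChart X n → CSpace n → ℂ,
      (∀ c ∈ A, DifferentiableOn ℂ (θ c) c.U ∧ ∀ z ∈ c.U, θ c z ≠ 0) ∧
      ∀ c ∈ A, ∀ d ∈ A, ∀ f, IsInjection c d f →
        ∃ u, IsDivisorTransition c f (s c) (s d) u ∧
          ∀ z ∈ c.U, θ c z * ((fderiv ℂ f z).det)⁻¹ = u z ^ α * θ d (f z)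

end Orbifold

/-! ### Volume forms with poles, and the basic assumption

From here on the dimension is `n = m + 1`. -/

section Pair

variable {X : Type u} [TopologicalSpace X] {m : ℕ}

/-- The chart `c` admits holomorphic coordinates `ζ` with (i) `D̃ = {ζₙ = 0}` in which (ii) every
`γ ∈ Γ` acts as a matrix with last row `(0, …, 0, b)` and upper left block `A`, where
`b = det(A)^{1/(α-1)}`, that is, `b` is an `(α-1)`-th root of `det A`. -/
def OrbChart.IsAdapted (c : OrbChart X (m + 1)) (D : Set X) (α : ℕ) : Prop :=
  ∃ ζ : CSpace (m + 1) → CSpace (m + 1),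
    DifferentiableOn ℂ ζ c.U ∧ Set.InjOn ζ c.U ∧
    (∀ z ∈ c.U, Function.Injective (fderiv ℂ ζ z)) ∧
    (∀ z ∈ c.U, c.proj z ∈ D ↔ ζ z (Fin.last m) = 0) ∧
    ∀ γ ∈ c.Γ, ∃ M : Matrix (Fin (m + 1)) (Fin (m + 1)) ℂ,
      (∀ j : Fin m, M (Fin.last m) j.castSucc = 0) ∧
      M (Fin.last m) (Fin.last m) ^ (α - 1) = (M.submatrix Fin.castSucc Fin.castSucc).det ∧
      ∀ z ∈ c.U, ζ (γ z) = M.mulVec (ζ z)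

/-- The basic assumption on the pair `(X, D)`. -/
def ComplexOrbifold.BasicAssumption (O : ComplexOrbifold X (m + 1)) (D : Set X) (α : ℕ) : Prop :=
  ∀ x ∈ D, ∃ c ∈ O.atlas, x ∈ c.range ∧ c.IsAdapted D α

/-- A holomorphic volume form `Ω` on `X \ D`: for each uniformising chart a nowhere vanishing
holomorphic `n`-form `φ^*Ω` on `Ũ \ D̃`, compatible with all injections. -/
structure HolVolForm (O : ComplexOrbifold X (m + 1)) (D : Set X) where
  /-- the form `φ^*Ω` in each chart -/
  form : O.atlas → CSpace (m + 1) → (CSpace (m + 1)) [⋀^Fin (m + 1)]→L[ℂ] ℂ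
  holo : ∀ c : O.atlas, DifferentiableOn ℂ (form c) (c.1.U \ c.1.pre D)
  ne_zero : ∀ c : O.atlas, ∀ z ∈ c.1.U \ c.1.pre D, form c z ≠ 0
  invariant : ∀ (c d : O.atlas) (f : CSpace (m + 1) → CSpace (m + 1)), IsInjection c.1 d.1 f →
    ∀ z ∈ c.1.U \ c.1.pre D,
      (form d (f z)).compContinuousLinearMap (fderiv ℂ f z) = form c z

/-- `Ω`, as a section of `K_X`, blows up to order `α` along `D`: if `s` is a local defining
function of `D̃`, then `s^α φ^*Ω` extends to a nowhere vanishing holomorphic `n`-form across `D̃`. -/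
def HolVolForm.BlowsUpToOrder {O : ComplexOrbifold X (m + 1)} {D : Set X} (Ω : HolVolForm O D)
    (α : ℕ) : Prop :=
  ∀ c : O.atlas, ∀ z ∈ c.1.pre D, ∃ V ⊆ c.1.U, IsOpen V ∧ z ∈ V ∧
    ∃ s, IsDefiningFunctionOn (c.1.pre D) V s ∧
      ∃ Ψ : CSpace (m + 1) → (CSpace (m + 1)) [⋀^Fin (m + 1)]→L[ℂ] ℂ,
        DifferentiableOn ℂ Ψ V ∧ (∀ w ∈ V, Ψ w ≠ 0) ∧
        ∀ w ∈ V \ c.1.pre D, s w ^ α • Ω.form c w = Ψ w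

/-- The value at `z ∈ D̃` of the holomorphic extension of `s^α φ^*Ω` to `Ũ`, where `s` is a defining
function of `D̃`. If `Ω` blows up to order `α`, the limit exists. -/
noncomputable def HolVolForm.clearedForm {O : ComplexOrbifold X (m + 1)} {D : Set X}
    (Ω : HolVolForm O D) (α : ℕ) (c : O.atlas) (s : CSpace (m + 1) → ℂ) (z : CSpace (m + 1)) :
    (CSpace (m + 1)) [⋀^Fin (m + 1)]→L[ℂ] ℂ :=
  Filter.limUnder (𝓝[c.1.U \ c.1.pre D] z) (fun w => s w ^ α • Ω.form c w)

/-! ### The total spaces `N_D \ {0}` and `K_D \ {0}` -/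

/-- The holomorphic tangent space `T_z S`: the vectors that are annihilated by the differentials of
all holomorphic germs at `z` vanishing on `S`. For a complex submanifold `S = {s = 0}` of
codimension one, this is the kernel of `ds`. -/
noncomputable def tangentTo {n : ℕ} (S : Set (CSpace n)) (z : CSpace n) :
    Submodule ℂ (CSpace n) :=
  ⨅ (f : CSpace n → ℂ) (_ : ∀ᶠ w in 𝓝 z, DifferentiableAt ℂ f w ∧ (w ∈ S → f w = 0)),
    LinearMap.ker (fderiv ℂ f z).toLinearMap

/-- The points of `N_D̃ \ {0}`: a point `z ∈ D̃` and a non-zero vector of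
`N_D̃|_z = T_z Ũ / T_z D̃`. -/
structure NormalPt (c : OrbChart X (m + 1)) (D : Set X) where
  pt : CSpace (m + 1)
  mem : pt ∈ c.pre D
  vec : CSpace (m + 1) ⧸ tangentTo (c.pre D) pt
  ne_zero : vec ≠ 0

/-- The point of `N_D̃ \ {0}` represented by `z ∈ D̃` and a vector `v` that is not tangent to
`D̃`. -/
noncomputable def NormalPt.ofVec {c : OrbChart X (m + 1)} {D : Set X}
    (p : {p : CSpace (m + 1) × CSpace (m + 1) //
      p.1 ∈ c.pre D ∧ p.2 ∉ tangentTo (c.pre D) p.1}) : NormalPt c D where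
  pt := p.1.1
  mem := p.2.1
  vec := Submodule.Quotient.mk p.1.2
  ne_zero := fun h => p.2.2 ((Submodule.Quotient.mk_eq_zero _).1 h)

/-- The topology of `N_D̃ \ {0}` as a quotient bundle of the trivial bundle `TŨ|_D̃`. -/
noncomputable instance (c : OrbChart X (m + 1)) (D : Set X) : TopologicalSpace (NormalPt c D) :=
  TopologicalSpace.coinduced NormalPt.ofVec inferInstance

/-- The points of `K_D̃ \ {0}`: a point `z ∈ D̃` and a non-zero alternating `(n-1)`-form on
`T_z D̃`. -/
structure CanonPt (c : OrbChart X (m + 1)) (D : Set X) where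
  pt : CSpace (m + 1)
  mem : pt ∈ c.pre D
  form : (tangentTo (c.pre D) pt) [⋀^Fin m]→L[ℂ] ℂ
  ne_zero : form ≠ 0

/-- The restriction of an `(n-1)`-form on `T_z Ũ` to `T_z D̃`. -/
noncomputable def restrictForm (c : OrbChart X (m + 1)) (D : Set X) (z : CSpace (m + 1))
    (η : (CSpace (m + 1)) [⋀^Fin m]→L[ℂ] ℂ) : (tangentTo (c.pre D) z) [⋀^Fin m]→L[ℂ] ℂ :=
  η.compContinuousLinearMap (tangentTo (c.pre D) z).subtypeL

/-- The point of `K_D̃ \ {0}` represented by `z ∈ D̃` and an `(n-1)`-form on `T_z Ũ` that does not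
vanish on `T_z D̃`. -/
noncomputable def CanonPt.ofForm {c : OrbChart X (m + 1)} {D : Set X}
    (p : {p : CSpace (m + 1) × (CSpace (m + 1)) [⋀^Fin m]→L[ℂ] ℂ //
      p.1 ∈ c.pre D ∧ restrictForm c D p.1 p.2 ≠ 0}) : CanonPt c D where
  pt := p.1.1
  mem := p.2.1
  form := restrictForm c D p.1.1 p.1.2
  ne_zero := p.2.2

/-- The topology of `K_D̃ \ {0}`, where `K_D̃` is regarded as a quotient bundle of the trivial bundle
`Λ^{n-1} T^*Ũ|_D̃`. -/
noncomputable instance (c : OrbChart X (m + 1)) (D : Set X) : TopologicalSpace (CanonPt c D) :=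
  TopologicalSpace.coinduced CanonPt.ofForm inferInstance

/-- The point `q` of `N_D̃' \ {0}` is the image of the point `p` of `N_D̃ \ {0}` under the map
`(z, [v]) ↦ (f(z), [df_z(v)])` induced by the injection `f`. -/
def NormalRel {D : Set X} {c d : OrbChart X (m + 1)} (f : CSpace (m + 1) → CSpace (m + 1))
    (p : NormalPt c D) (q : NormalPt d D) : Prop :=
  q.pt = f p.pt ∧ ∃ v : CSpace (m + 1),
    p.vec = Submodule.Quotient.mk v ∧ q.vec = Submodule.Quotient.mk (fderiv ℂ f p.pt v)

/-- The point `q` of `K_D̃' \ {0}` is the image of the point `p` of `K_D̃ \ {0}` under the map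
induced by the injection `f`: the form of `p` is the pullback under `f|_D̃` of the form of `q`. -/
def CanonRel {D : Set X} {c d : OrbChart X (m + 1)} (f : CSpace (m + 1) → CSpace (m + 1))
    (p : CanonPt c D) (q : CanonPt d D) : Prop :=
  q.pt = f p.pt ∧
    ∀ (u : Fin m → tangentTo (c.pre D) p.pt) (u' : Fin m → tangentTo (d.pre D) q.pt),
      (∀ i, (u' i : CSpace (m + 1)) = fderiv ℂ f p.pt (u i)) → q.form u' = p.form u

/-- Underlying space of the orbifold `N_D \ {0}`: the spaces `N_D̃ \ {0}` of all uniformising charts,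
glued along all injections (including the elements of the local uniformising groups). -/
def NormalTotal (O : ComplexOrbifold X (m + 1)) (D : Set X) : Type u :=
  Quot (fun p q : Σ c : O.atlas, NormalPt c.1 D =>
    ∃ f, IsInjection p.1.1 q.1.1 f ∧ NormalRel f p.2 q.2)

/-- Underlying space of the orbifold `K_D \ {0}`. -/
def CanonTotal (O : ComplexOrbifold X (m + 1)) (D : Set X) : Type u :=
  Quot (fun p q : Σ c : O.atlas, CanonPt c.1 D =>
    ∃ f, IsInjection p.1.1 q.1.1 f ∧ CanonRel f p.2 q.2)

noncomputable instance (O : ComplexOrbifold X (m + 1)) (D : Set X) : TopologicalSpace (NormalTotal O D) :=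
  inferInstanceAs (TopologicalSpace (Quot _))

noncomputable instance (O : ComplexOrbifold X (m + 1)) (D : Set X) :
    TopologicalSpace (CanonTotal O D) :=
  inferInstanceAs (TopologicalSpace (Quot _))

/-- The projection of the uniformising chart `N_D̃ \ {0}` of `N_D \ {0}`. -/
def NormalTotal.mk (O : ComplexOrbifold X (m + 1)) (D : Set X) (c : O.atlas)
    (p : NormalPt c.1 D) : NormalTotal O D := Quot.mk _ ⟨c, p⟩

/-- The projection of the uniformising chart `K_D̃ \ {0}` of `K_D \ {0}`. -/
def CanonTotal.mk (O : ComplexOrbifold X (m + 1)) (D : Set X) (c : O.atlas)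
    (p : CanonPt c.1 D) : CanonTotal O D := Quot.mk _ ⟨c, p⟩

/-! ### Orbifold maps from `N_D \ {0}` to `K_D \ {0}` -/

/-- A map of orbifolds `N_D \ {0} → K_D \ {0}`: a map of the underlying spaces together with lifts
`N_D̃ \ {0} → K_D̃ \ {0}` to the uniformising charts that are compatible with all injections; in
particular the lift to the chart with group `Γ` is `Γ`-equivariant. -/
structure NormalToCanonMap (O : ComplexOrbifold X (m + 1)) (D : Set X) where
  toFun : NormalTotal O D → CanonTotal O D
  lift : ∀ c : O.atlas, NormalPt c.1 D → CanonPt c.1 D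
  toFun_mk : ∀ (c : O.atlas) (p : NormalPt c.1 D),
    toFun (NormalTotal.mk O D c p) = CanonTotal.mk O D c (lift c p)
  compat : ∀ (c d : O.atlas) (f : CSpace (m + 1) → CSpace (m + 1)), IsInjection c.1 d.1 f →
    ∀ (p : NormalPt c.1 D) (q : NormalPt d.1 D),
      NormalRel f p q → CanonRel f (lift c p) (lift d q)

/-- The map is holomorphic: each lift `N_D̃ \ {0} → K_D̃ \ {0}` is holomorphic, which means that it
is locally induced by a holomorphic map `F` from an open set of `TŨ = Ũ × ℂⁿ` to
`Λ^{n-1} T^*Ũ ⊂ ℂⁿ × Λ^{n-1}(ℂⁿ)^*`. -/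
def NormalToCanonMap.IsHolomorphic {O : ComplexOrbifold X (m + 1)} {D : Set X}
    (φ : NormalToCanonMap O D) : Prop :=
  ∀ (c : O.atlas) (z v : CSpace (m + 1)), z ∈ c.1.pre D → v ∉ tangentTo (c.1.pre D) z →
    ∃ W : Set (CSpace (m + 1) × CSpace (m + 1)), IsOpen W ∧ (z, v) ∈ W ∧
      ∃ F : CSpace (m + 1) × CSpace (m + 1) →
          CSpace (m + 1) × (CSpace (m + 1)) [⋀^Fin m]→L[ℂ] ℂ,
        DifferentiableOn ℂ F W ∧
        ∀ p : {p : CSpace (m + 1) × CSpace (m + 1) //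
            p.1 ∈ c.1.pre D ∧ p.2 ∉ tangentTo (c.1.pre D) p.1}, p.1 ∈ W →
          ∃ h : (F p.1).1 ∈ c.1.pre D ∧ restrictForm c.1 D (F p.1).1 (F p.1).2 ≠ 0,
            φ.lift c (NormalPt.ofVec p) = CanonPt.ofForm ⟨F p.1, h⟩

/-- The map is an unbranched `k`-fold covering map of orbifolds: it is continuous and surjective,
and its equivariant lift to each uniformising chart is a covering map all of whose fibres have
exactly `k` points. -/
def NormalToCanonMap.IsUnbranchedCovering {O : ComplexOrbifold X (m + 1)} {D : Set X}
    (φ : NormalToCanonMap O D) (k : ℕ) : Prop :=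
  Continuous φ.toFun ∧ Function.Surjective φ.toFun ∧
    ∀ c : O.atlas, IsCoveringMap (φ.lift c) ∧ ∀ y, Nat.card (φ.lift c ⁻¹' {y}) = k

/-- In each uniformising chart with coordinates as in the basic assumption, and for each defining
function `s` of `D̃` on `Ũ`, the map is
`(z, λ ∂/∂s) ↦ (z, λ^{1-α} ((s^α φ^*Ω) ⌟ ∂/∂s)|_D̃)`. Here `∂/∂s` is the class in `N_D̃|_z` of any
vector `v` with `ds(v) = 1`. -/
def NormalToCanonMap.IsResidueMap {O : ComplexOrbifold X (m + 1)} {D : Set X}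
    (φ : NormalToCanonMap O D) (Ω : HolVolForm O D) (α : ℕ) : Prop :=
  ∀ c : O.atlas, c.1.IsAdapted D α →
    ∀ s : CSpace (m + 1) → ℂ, IsDefiningFunctionOn (c.1.pre D) c.1.U s →
      ∀ (p : NormalPt c.1 D) (v : CSpace (m + 1)) (lam : ℂ), lam ≠ 0 →
        fderiv ℂ s p.pt v = 1 → p.vec = lam • Submodule.Quotient.mk v →
        (φ.lift c p).pt = p.pt ∧
        ∀ u : Fin m → tangentTo (c.1.pre D) (φ.lift c p).pt,
          (φ.lift c p).form u = lam ^ (1 - (α : ℤ)) *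
            Ω.clearedForm α c s p.pt (Matrix.vecCons v (fun i => (u i : CSpace (m + 1))))

end Pair

/-!
Let `s` be a defining function of `D̃`. The leading coefficient `Ψ = s ^ α • φ^*Ω` along `D̃` is
multiplied by `u ^ α` when `s` is replaced by `u s`, so `v ↦ ds(v) ^ (-α) • (Ψ ⌟ v)|_D̃` does not
depend on `s`. Moreover it only depends on the class of `v` in the normal bundle, is homogeneous of
degree `1 - α` and commutes with all injections. It therefore defines `φ_Ω`, which in local frames
of the two line bundles is `λ ↦ λ ^ (1 - α)` and hence an `(α - 1)`-fold covering.

Locally `-K_X = α[D]` provides the form `θ s ^ (-α) dz₁ ∧ ⋯ ∧ dzₙ` with a nowhere vanishing function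
`θ`, and these forms agree under injections. They extend from the charts of one atlas to all
compatible charts, because off `D` the isotropy is trivial and so the transition germs are unique.

A map of orbifolds is determined by its lifts to adapted charts: any chart is related to these near
a point of `D̃` by injections from a common smaller chart.
-/

/-! ### Holomorphic maps of several variables -/

section Holomorphic

open Metric MeasureTheory Filter

variable {E F : Type*} [NormedAddCommGroup E] [NormedSpace ℂ E] [NormedAddCommGroup F]
  [NormedSpace ℂ F] {f : E → F} {z v : E} {r C : ℝ}

theorem fderiv_apply_eq_circleIntegral [CompleteSpace F] (hr : 0 < r)
    (hf : ∀ ζ ∈ closedBall (0 : ℂ) r, DifferentiableAt ℂ f (z + ζ • v)) :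
    fderiv ℂ f z v =
      (2 * Real.pi * Complex.I)⁻¹ • ∮ ζ in C(0, r), (1 / (ζ - 0) ^ 2) • f (z + ζ • v) := by
  have hline (ζ : ℂ) : HasDerivAt (fun ζ : ℂ => z + ζ • v) v ζ := by
    simpa using ((hasDerivAt_id ζ).smul_const v).const_add z
  have hd : DifferentiableOn ℂ (fun ζ : ℂ => f (z + ζ • v)) (closedBall 0 r) := fun ζ hζ =>
    ((hf ζ hζ).comp ζ (hline ζ).differentiableAt).differentiableWithinAt
  rw [hd.deriv_eq_smul_circleIntegral hr, smul_smul,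
    inv_mul_cancel₀ Complex.two_pi_I_ne_zero, one_smul]
  have h0 : HasFDerivAt f (fderiv ℂ f (z + (0 : ℂ) • v)) (z + (0 : ℂ) • v) :=
    (hf 0 (mem_closedBall_self hr.le)).hasFDerivAt
  simpa [Function.comp_def] using (h0.comp_hasDerivAt (0 : ℂ) (hline 0)).deriv.symm

theorem exists_eventually_norm_fderiv_le (hf : ∀ᶠ w in 𝓝 z, DifferentiableAt ℂ f w) :
    ∃ C, ∀ᶠ w in 𝓝 z, ‖fderiv ℂ f w‖ ≤ C := by
  have hnear : ∀ᶠ w in 𝓝 z, DifferentiableAt ℂ f w ∧ dist (f w) (f z) < 1 :=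
    hf.and (hf.self_of_nhds.continuousAt.eventually (ball_mem_nhds _ one_pos))
  obtain ⟨ε, hε, hball⟩ := Metric.eventually_nhds_iff_ball.1 hnear
  refine ⟨2 / (ε / 2), Filter.mem_of_superset (ball_mem_nhds z (half_pos hε)) fun y hy => ?_⟩
  have hsub : ball y (ε / 2) ⊆ ball z ε :=
    ball_subset_ball' (by linarith [mem_ball.1 hy])
  refine Complex.norm_fderiv_le_div_of_mapsTo_ball
    (fun w hw => (hball w (hsub hw)).1.differentiableWithinAt) (fun w hw => ?_) (half_pos hε)
  rw [mem_closedBall]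
  linarith [dist_triangle_right (f w) (f y) (f z), (hball w (hsub hw)).2,
    (hball y (hsub (mem_ball_self (half_pos hε)))).2]

theorem exists_forall_closedBall_of_eventually {P : E → Prop} (h : ∀ᶠ w in 𝓝 z, P w) (v : E) :
    ∃ r > 0, ∀ᶠ w in 𝓝 z, ∀ ζ ∈ closedBall (0 : ℂ) r, P (w + ζ • v) := by
  have hlim : Tendsto (fun p : E × ℂ => p.1 + p.2 • v) (𝓝 z ×ˢ 𝓝 0) (𝓝 z) := by
    rw [← nhds_prod_eq]
    exact Continuous.tendsto' (by fun_prop) _ _ (by simp)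
  obtain ⟨A, hA, B, hB, hAB⟩ := eventually_prod_iff.1 (hlim.eventually h)
  obtain ⟨r, hr, hrB⟩ := nhds_basis_closedBall.eventually_iff.1 hB
  exact ⟨r, hr, hA.mono fun w hw ζ hζ => hAB hw (hrB hζ)⟩

variable [FiniteDimensional ℂ E] [FiniteDimensional ℂ F]

theorem differentiableAt_circleIntegral_smul_translate {k : ℂ → ℂ} (hr : 0 ≤ r)
    (hk : ContinuousOn k (sphere 0 r))
    (hf : ∀ᶠ w in 𝓝 z, ∀ ζ ∈ sphere (0 : ℂ) r,
      DifferentiableAt ℂ f (w + ζ • v) ∧ ‖fderiv ℂ f (w + ζ • v)‖ ≤ C) :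
    DifferentiableAt ℂ (fun w => ∮ ζ in C(0, r), k ζ • f (w + ζ • v)) z := by
  have : CompleteSpace F := FiniteDimensional.complete ℂ F
  have : ProperSpace E := FiniteDimensional.proper ℂ E
  have : ProperSpace F := FiniteDimensional.proper ℂ F
  have : ProperSpace (E →L[ℂ] F) := FiniteDimensional.proper ℂ _
  borelize E F (E →L[ℂ] F)
  have hmem (θ : ℝ) : circleMap 0 r θ ∈ sphere (0 : ℂ) r := circleMap_mem_sphere 0 hr θ
  have hweight : Continuous fun θ => deriv (circleMap 0 r) θ * k (circleMap 0 r θ) := by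
    simp only [deriv_circleMap]
    exact ((continuous_circleMap 0 r).mul continuous_const).mul
      (hk.comp_continuous (continuous_circleMap 0 r) hmem)
  set κ : ℝ → ℂ := fun θ => deriv (circleMap 0 r) θ * k (circleMap 0 r θ) with hκ
  have hcont : ∀ᶠ w in 𝓝 z, Continuous fun θ : ℝ => κ θ • f (w + circleMap 0 r θ • v) := by
    filter_upwards [hf] with w hw
    refine hweight.smul (continuous_iff_continuousAt.2 fun θ => ?_)
    exact ContinuousAt.comp (f := fun θ : ℝ => w + circleMap 0 r θ • v)
      (hw _ (hmem θ)).1.continuousAt (by fun_prop)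
  have hmeas : Measurable fun θ : ℝ => fderiv ℂ f (z + circleMap 0 r θ • v) :=
    (measurable_fderiv ℂ f).comp
      (by fun_prop : Continuous fun θ : ℝ => z + circleMap 0 r θ • v).measurable
  have hparam (θ : ℝ) (w : E) (hw : DifferentiableAt ℂ f (w + circleMap 0 r θ • v)) :
      HasFDerivAt (fun w => κ θ • f (w + circleMap 0 r θ • v))
        (κ θ • fderiv ℂ f (w + circleMap 0 r θ • v)) w := by
    simpa using! (hw.hasFDerivAt.comp w ((hasFDerivAt_id w).add_const _)).const_smul (κ θ)
  have hintegral := intervalIntegral.hasFDerivAt_integral_of_dominated_of_fderiv_le (𝕜 := ℂ)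
    (μ := volume) (a := 0) (b := 2 * Real.pi)
    (F := fun w θ => κ θ • f (w + circleMap 0 r θ • v))
    (F' := fun w θ => κ θ • fderiv ℂ f (w + circleMap 0 r θ • v)) (x₀ := z)
    (bound := fun θ => ‖κ θ‖ * C) hf (hcont.mono fun w hw => hw.aestronglyMeasurable)
    (hcont.self_of_nhds.intervalIntegrable _ _)
    (hweight.aestronglyMeasurable.smul hmeas.aestronglyMeasurable)
    (.of_forall fun θ _ w hw => by rw [norm_smul]; gcongr; exact (hw _ (hmem θ)).2)
    ((hweight.norm.mul continuous_const).intervalIntegrable _ _)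
    (.of_forall fun θ _ w hw => hparam θ w (hw _ (hmem θ)).1)
  simpa only [circleIntegral, hκ, mul_smul] using! hintegral.differentiableAt

theorem differentiableAt_fderiv_apply (hf : ∀ᶠ w in 𝓝 z, DifferentiableAt ℂ f w) (v : E) :
    DifferentiableAt ℂ (fun w => fderiv ℂ f w v) z := by
  have : CompleteSpace F := FiniteDimensional.complete ℂ F
  obtain ⟨C, hC⟩ := exists_eventually_norm_fderiv_le hf
  obtain ⟨r, hr, hrv⟩ := exists_forall_closedBall_of_eventually (hf.and hC) v
  have hcauchy : (fun w => fderiv ℂ f w v) =ᶠ[𝓝 z] fun w =>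
      (2 * Real.pi * Complex.I)⁻¹ • ∮ ζ in C(0, r), (1 / (ζ - 0) ^ 2) • f (w + ζ • v) :=
    hrv.mono fun w hw => fderiv_apply_eq_circleIntegral hr fun ζ hζ => (hw ζ hζ).1
  refine DifferentiableAt.congr_of_eventuallyEq (.const_smul ?_ _) hcauchy
  refine differentiableAt_circleIntegral_smul_translate (k := fun ζ => 1 / (ζ - 0) ^ 2) hr.le ?_
    (hrv.mono fun w hw ζ hζ => hw ζ (sphere_subset_closedBall hζ))
  refine continuousOn_const.div (by fun_prop) fun ζ hζ => pow_ne_zero 2 ?_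
  simpa using ne_zero_of_mem_sphere hr.ne' ⟨ζ, hζ⟩

theorem differentiableAt_fderiv (hf : ∀ᶠ w in 𝓝 z, DifferentiableAt ℂ f w) :
    DifferentiableAt ℂ (fderiv ℂ f) z := by
  let b := Module.finBasis ℂ E
  let e := (b.equivFunL.arrowCongr (ContinuousLinearEquiv.refl ℂ F)).trans
    (ContinuousLinearEquiv.piRing (Fin (Module.finrank ℂ E)))
  refine (e.comp_differentiableAt_iff).1 (differentiableAt_pi.2 fun i => ?_)
  exact differentiableAt_fderiv_apply hf _

theorem differentiableOn_fderiv {U : Set E} (hU : IsOpen U) (hf : DifferentiableOn ℂ f U) :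
    DifferentiableOn ℂ (fderiv ℂ f) U := fun _ hw =>
  (differentiableAt_fderiv (hf.eventually_differentiableAt
    (hU.mem_nhds hw))).differentiableWithinAt

theorem hasStrictFDerivAt_of_eventually (hf : ∀ᶠ w in 𝓝 z, DifferentiableAt ℂ f w) :
    HasStrictFDerivAt f (fderiv ℂ f z) z :=
  hasStrictFDerivAt_of_hasFDerivAt_of_continuousAt (hf.mono fun _ hw => hw.hasFDerivAt)
    (differentiableAt_fderiv hf).continuousAt

end Holomorphic

section InverseFunction

open Filter

variable {E : Type*} [NormedAddCommGroup E] [NormedSpace ℂ E] [FiniteDimensional ℂ E]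
  {h : E → E} {z : E}

theorem eventually_injective_fderiv (hh : ∀ᶠ w in 𝓝 z, DifferentiableAt ℂ h w)
    (hinj : Function.Injective (fderiv ℂ h z)) :
    ∀ᶠ w in 𝓝 z, Function.Injective (fderiv ℂ h w) :=
  (differentiableAt_fderiv hh).continuousAt.eventually
    (ContinuousLinearMap.isOpen_injective.mem_nhds hinj)

theorem exists_openPartialHomeomorph_of_injective_fderiv
    (hh : ∀ᶠ w in 𝓝 z, DifferentiableAt ℂ h w) (hinj : Function.Injective (fderiv ℂ h z)) :
    ∃ e : OpenPartialHomeomorph E E, ⇑e = h ∧ z ∈ e.source ∧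
      ∀ᶠ w in 𝓝 (h z), DifferentiableAt ℂ e.symm w := by
  have : CompleteSpace E := FiniteDimensional.complete ℂ E
  have hequiv {w : E} (hw : Function.Injective (fderiv ℂ h w)) :
      ∃ L : E ≃L[ℂ] E, (L : E →L[ℂ] E) = fderiv ℂ h w :=
    ⟨(LinearEquiv.ofInjectiveEndo (fderiv ℂ h w).toLinearMap hw).toContinuousLinearEquiv, rfl⟩
  obtain ⟨L, hL⟩ := hequiv hinj
  have hstrict : HasStrictFDerivAt h (L : E →L[ℂ] E) z := hL ▸ hasStrictFDerivAt_of_eventually hh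
  let e := hstrict.toOpenPartialHomeomorph h
  have hz : z ∈ e.source := hstrict.mem_toOpenPartialHomeomorph_source
  have hsymm : Tendsto e.symm (𝓝 (h z)) (𝓝 z) := by
    have := (e.continuousAt_symm (e.map_source hz)).tendsto
    rwa [e.left_inv hz] at this
  refine ⟨e, rfl, hz, ?_⟩
  filter_upwards [e.open_target.mem_nhds (e.map_source hz), hsymm.eventually hh,
    hsymm.eventually (eventually_injective_fderiv hh hinj)] with w hw hdiff hinj'
  obtain ⟨M, hM⟩ := hequiv hinj'
  exact (e.hasFDerivAt_symm hw (f' := M) (hM ▸ hdiff.hasFDerivAt)).differentiableAt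

end InverseFunction

/-! ### Defining functions of hypersurfaces -/

section ZeroLocus

open Asymptotics Filter

variable {𝕜 E F : Type*} [NontriviallyNormedField 𝕜] [NormedAddCommGroup E] [NormedSpace 𝕜 E]
  [NormedAddCommGroup F] [NormedSpace 𝕜 F] {s μ : E → 𝕜} {ℓ : E →L[𝕜] 𝕜} {f : E → F}
  {f' : E →L[𝕜] F} {ρ : E → E} {z v : E}

theorem exists_projection_zeroLocus [CompleteSpace E] (hs : HasStrictFDerivAt s ℓ z)
    (hz : s z = 0) (hv : ℓ v = 1) :
    ∃ ρ : E → E, Tendsto ρ (𝓝 z) (𝓝 z) ∧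
      ∀ᶠ w in 𝓝 z, s (ρ w) = 0 ∧ w - ρ w = ℓ (w - ρ w) • v := by
  -- In the coordinates `Φ` the function `s` becomes the linear function `ℓ`.
  let Φ : E → E := fun w => w + (s w - ℓ w) • v
  have hΦ : HasStrictFDerivAt Φ (ContinuousLinearEquiv.refl 𝕜 E : E →L[𝕜] E) z := by
    have h : HasStrictFDerivAt Φ (ContinuousLinearMap.id 𝕜 E + (ℓ - ℓ).smulRight v) z :=
      (hasStrictFDerivAt_id z).add ((hs.sub ℓ.hasStrictFDerivAt).smul_const v)
    rwa [sub_self, ContinuousLinearMap.zero_smulRight, add_zero] at h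
  have hℓΦ (w : E) : ℓ (Φ w) = s w := by simp [Φ, hv]
  have hproj : Tendsto (fun w => Φ w - s w • v) (𝓝 z) (𝓝 (Φ z)) := by
    have hs0 : Tendsto s (𝓝 z) (𝓝 0) := hz ▸ hs.continuousAt.tendsto
    simpa using hΦ.continuousAt.tendsto.sub (hs0.smul_const v)
  refine ⟨fun w => hΦ.localInverse Φ _ z (Φ w - s w • v), hΦ.localInverse_tendsto.comp hproj, ?_⟩
  filter_upwards [hproj.eventually hΦ.eventually_right_inverse] with w hw
  set w₀ := hΦ.localInverse Φ _ z (Φ w - s w • v)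
  have hw₀ : s w₀ = 0 := by simpa [hℓΦ, hv] using congrArg ℓ hw
  refine ⟨hw₀, ?_⟩
  simp only [Φ, hw₀] at hw
  rw [map_sub]
  linear_combination (norm := module) -hw

theorem isLittleO_sub_smul_of_projection (hf : HasStrictFDerivAt f f' z)
    (hρ : Tendsto ρ (𝓝 z) (𝓝 z)) (hfρ : ∀ᶠ w in 𝓝 z, f (ρ w) = 0)
    (hμ : ∀ᶠ w in 𝓝 z, w - ρ w = μ w • v) :
    (fun w => f w - μ w • f' v) =o[𝓝 z] μ := by
  have hpair : Tendsto (fun w => (w, ρ w)) (𝓝 z) (𝓝 (z, z)) := tendsto_id.prodMk_nhds hρ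
  have hO : (fun w => w - ρ w) =O[𝓝 z] μ := .of_bound ‖v‖ <| hμ.mono fun w hw => by
    rw [hw, norm_smul, mul_comm]
  refine ((hf.isLittleO.comp_tendsto hpair).trans_isBigO hO).congr' ?_ .rfl
  filter_upwards [hfρ, hμ] with w hfw hμw
  simp only [Function.comp_apply, hfw, hμw, sub_zero, map_smul]

theorem isLittleO_sub_smul_of_vanishing [CompleteSpace E] (hs : HasStrictFDerivAt s ℓ z)
    (hz : s z = 0) (hv : ℓ v = 1) (hf : HasStrictFDerivAt f f' z)
    (hfs : ∀ᶠ w in 𝓝 z, s w = 0 → f w = 0) : (fun w => f w - s w • f' v) =o[𝓝 z] s := by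
  obtain ⟨ρ, hρ, h⟩ := exists_projection_zeroLocus hs hz hv
  have hμ : ∀ᶠ w in 𝓝 z, w - ρ w = ℓ (w - ρ w) • v := h.mono fun _ hw => hw.2
  have hsμ : (fun w => s w - ℓ (w - ρ w) • ℓ v) =o[𝓝 z] fun w => ℓ (w - ρ w) :=
    isLittleO_sub_smul_of_projection hs hρ (h.mono fun _ hw => hw.1) hμ
  have hfμ := isLittleO_sub_smul_of_projection hf hρ
    (h.mp ((hρ.eventually hfs).mono fun _ h1 h2 => h1 h2.1)) hμ
  simp only [hv, smul_eq_mul, mul_one] at hsμ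
  have hμs : (fun w => ℓ (w - ρ w)) =O[𝓝 z] s := (IsEquivalent.symm (u := s) hsμ).isBigO
  have hdiff : (fun w => (s w - ℓ (w - ρ w)) • f' v) =o[𝓝 z] fun w => ℓ (w - ρ w) :=
    (hsμ.smul_isBigO (isBigO_const_const (f' v) (one_ne_zero (α := 𝕜)) _)).congr_right
      fun _ => mul_one _
  refine ((hfμ.sub hdiff).congr_left fun w => ?_).trans_isBigO hμs
  rw [sub_smul]
  abel

theorem fderiv_eq_smulRight_of_vanishing [CompleteSpace E] (hs : HasStrictFDerivAt s ℓ z)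
    (hz : s z = 0) (hv : ℓ v = 1) (hf : HasStrictFDerivAt f f' z)
    (hfs : ∀ᶠ w in 𝓝 z, s w = 0 → f w = 0) : f' = ℓ.smulRight (f' v) := by
  have hsO : s =O[𝓝 z] fun w => w - z := by simpa [hz] using hs.hasFDerivAt.isBigO_sub
  have hzero : HasFDerivAt (fun w => f w - s w • f' v) (0 : E →L[𝕜] F) z := by
    rw [hasFDerivAt_iff_isLittleO]
    simpa [hz, hfs.self_of_nhds hz] using
      (isLittleO_sub_smul_of_vanishing hs hz hv hf hfs).trans_isBigO hsO
  exact sub_eq_zero.1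
    ((hf.hasFDerivAt.sub (hs.hasFDerivAt.smul_const (f' v))).unique hzero)

end ZeroLocus

section LocalDefining

open Asymptotics Filter

variable {n : ℕ} {S T : Set (CSpace n)} {s t f : CSpace n → ℂ} {h : CSpace n → CSpace n}
  {z v : CSpace n}

/-- `s` is a holomorphic defining function of the germ of the smooth hypersurface `S` at its
point `z`. -/
structure IsLocalDefining (S : Set (CSpace n)) (s : CSpace n → ℂ) (z : CSpace n) : Prop where
  mem : z ∈ S
  holo : ∀ᶠ w in 𝓝 z, DifferentiableAt ℂ s w
  zero_iff : ∀ᶠ w in 𝓝 z, s w = 0 ↔ w ∈ S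
  deriv_ne : fderiv ℂ s z ≠ 0

theorem IsDefiningFunctionOn.isLocalDefining {V : Set (CSpace n)}
    (hs : IsDefiningFunctionOn S V s) (hV : IsOpen V) (hz : z ∈ V) (hzS : z ∈ S) :
    IsLocalDefining S s z where
  mem := hzS
  holo := hs.holo.eventually_differentiableAt (hV.mem_nhds hz)
  zero_iff := eventually_of_mem (hV.mem_nhds hz) hs.zero_iff
  deriv_ne := hs.deriv_ne z hz hzS

theorem IsLocalDefining.apply_eq_zero (hs : IsLocalDefining S s z) : s z = 0 :=
  hs.zero_iff.self_of_nhds.2 hs.mem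

theorem IsLocalDefining.exists_fderiv_apply_eq_one (hs : IsLocalDefining S s z) :
    ∃ v, fderiv ℂ s z v = 1 :=
  LinearMap.surjective (ContinuousLinearMap.coe_injective.ne hs.deriv_ne) 1

theorem IsLocalDefining.exists_isLittleO_and_fderiv_eq (hs : IsLocalDefining S s z)
    (hf : ∀ᶠ w in 𝓝 z, DifferentiableAt ℂ f w) (hfS : ∀ᶠ w in 𝓝 z, w ∈ S → f w = 0) :
    ∃ k : ℂ, (fun w => f w - s w * k) =o[𝓝 z] s ∧ fderiv ℂ f z = k • fderiv ℂ s z := by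
  obtain ⟨v, hv⟩ := hs.exists_fderiv_apply_eq_one
  have hss := hasStrictFDerivAt_of_eventually hs.holo
  have hfs := hasStrictFDerivAt_of_eventually hf
  have hzero : ∀ᶠ w in 𝓝 z, s w = 0 → f w = 0 :=
    hs.zero_iff.mp (hfS.mono fun _ h1 h2 => h1 ∘ h2.1)
  refine ⟨fderiv ℂ f z v, isLittleO_sub_smul_of_vanishing hss hs.apply_eq_zero hv hfs hzero, ?_⟩
  ext w
  rw [fderiv_eq_smulRight_of_vanishing hss hs.apply_eq_zero hv hfs hzero]
  simp [hv, mul_comm]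

theorem IsLocalDefining.tangentTo_eq (hs : IsLocalDefining S s z) :
    tangentTo S z = LinearMap.ker (fderiv ℂ s z).toLinearMap := by
  refine le_antisymm (iInf₂_le s (hs.holo.and (hs.zero_iff.mono fun _ h => h.2)))
    (le_iInf₂ fun f hf u (hu : fderiv ℂ s z u = 0) => ?_)
  obtain ⟨k, -, hk⟩ := hs.exists_isLittleO_and_fderiv_eq (hf.mono fun _ h => h.1)
    (hf.mono fun _ h => h.2)
  simp [LinearMap.mem_ker, hk, hu]

theorem IsLocalDefining.mem_tangentTo (hs : IsLocalDefining S s z) :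
    v ∈ tangentTo S z ↔ fderiv ℂ s z v = 0 := by
  rw [hs.tangentTo_eq]
  rfl

theorem IsLocalDefining.neBot (hs : IsLocalDefining S s z) {U : Set (CSpace n)} (hU : U ∈ 𝓝 z) :
    (𝓝[U \ S] z).NeBot := by
  rw [← mem_closure_iff_nhdsWithin_neBot, mem_closure_iff_frequently]
  intro h
  have hzero : s =ᶠ[𝓝 z] fun _ => 0 := by
    filter_upwards [h, hs.zero_iff, hU] with w h1 h2 h3
    exact h2.2 (by_contra fun h4 => h1 ⟨h3, h4⟩)
  exact hs.deriv_ne (by rw [hzero.fderiv_eq, fderiv_const_apply])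

theorem IsLocalDefining.exists_tendsto_div (hs : IsLocalDefining S s z)
    (ht : IsLocalDefining S t z) :
    ∃ k : ℂ, k ≠ 0 ∧ fderiv ℂ t z = k • fderiv ℂ s z ∧
      Tendsto (fun w => t w / s w) (𝓝[Sᶜ] z) (𝓝 k) := by
  obtain ⟨k, hlittle, hderiv⟩ :=
    hs.exists_isLittleO_and_fderiv_eq ht.holo (ht.zero_iff.mono fun _ h => h.2)
  refine ⟨k, ?_, hderiv, ?_⟩
  · rintro rfl
    exact ht.deriv_ne (hderiv.trans (zero_smul ℂ (fderiv ℂ s z)))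
  · have hdiv := ((hlittle.mono nhdsWithin_le_nhds).tendsto_div_nhds_zero
      (l := 𝓝[Sᶜ] z)).add_const k
    rw [zero_add] at hdiv
    refine hdiv.congr' ?_
    filter_upwards [self_mem_nhdsWithin, nhdsWithin_le_nhds hs.zero_iff] with w hw hsw
    have : s w ≠ 0 := fun h => hw (hsw.1 h)
    field_simp
    ring

theorem IsLocalDefining.comp (hs : IsLocalDefining S s (h z))
    (hh : ∀ᶠ w in 𝓝 z, DifferentiableAt ℂ h w) (hinj : Function.Injective (fderiv ℂ h z))
    (hST : ∀ᶠ w in 𝓝 z, h w ∈ S ↔ w ∈ T) : IsLocalDefining T (s ∘ h) z where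
  mem := hST.self_of_nhds.1 hs.mem
  holo := (hh.self_of_nhds.continuousAt.eventually hs.holo).mp
    (hh.mono fun w h1 h2 => h2.comp w h1)
  zero_iff := (hh.self_of_nhds.continuousAt.eventually hs.zero_iff).mp
    (hST.mono fun _ h1 h2 => h2.trans h1)
  deriv_ne := by
    rw [fderiv_comp z hs.holo.self_of_nhds hh.self_of_nhds]
    intro h0
    refine hs.deriv_ne (ContinuousLinearMap.ext fun v => ?_)
    obtain ⟨w, rfl⟩ := LinearMap.injective_iff_surjective.1 hinj v
    exact DFunLike.congr_fun h0 w

theorem fderiv_mem_tangentTo (hh : ∀ᶠ w in 𝓝 z, DifferentiableAt ℂ h w)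
    (hST : ∀ᶠ w in 𝓝 z, w ∈ S → h w ∈ T) (hv : v ∈ tangentTo S z) :
    fderiv ℂ h z v ∈ tangentTo T (h z) := by
  simp only [tangentTo, Submodule.mem_iInf, LinearMap.mem_ker] at hv ⊢
  intro f hf
  have hfh := hv (f ∘ h) <| by
    filter_upwards [hh, hST, hh.self_of_nhds.continuousAt.eventually hf] with w h1 h2 h3
    exact ⟨h3.1.comp w h1, fun hw => h3.2 (h2 hw)⟩
  rwa [fderiv_comp z hf.self_of_nhds.1 hh.self_of_nhds] at hfh

end LocalDefining

/-! ### Transitions between uniformising charts -/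

section Transition

open Filter

variable {X : Type u} [TopologicalSpace X] {n : ℕ} {c d e : OrbChart X n}
  {f g h k : CSpace n → CSpace n} {z w v : CSpace n} {D : Set X}

/-- `h` is a germ at `z` of a biholomorphic map from the chart `c` to the chart `d` over `X`. -/
structure IsTransition (c d : OrbChart X n) (z : CSpace n) (h : CSpace n → CSpace n) : Prop where
  mem_U : z ∈ c.U
  holo : ∀ᶠ w in 𝓝 z, DifferentiableAt ℂ h w
  mem : ∀ᶠ w in 𝓝 z, h w ∈ d.U
  proj : ∀ᶠ w in 𝓝 z, d.proj (h w) = c.proj w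
  inj : Function.Injective (fderiv ℂ h z)

theorem IsInjection.isTransition (hf : IsInjection c d f) (hz : z ∈ c.U) :
    IsTransition c d z f where
  mem_U := hz
  holo := hf.holo.eventually_differentiableAt (c.isOpen_U.mem_nhds hz)
  mem := eventually_of_mem (c.isOpen_U.mem_nhds hz) fun _ hw => hf.mapsTo hw
  proj := eventually_of_mem (c.isOpen_U.mem_nhds hz) hf.proj_comp
  inj := hf.immersion z hz

theorem IsTransition.differentiableAt (hh : IsTransition c d z h) : DifferentiableAt ℂ h z :=
  hh.holo.self_of_nhds

theorem IsTransition.tendsto (hh : IsTransition c d z h) : Tendsto h (𝓝 z) (𝓝 (h z)) :=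
  hh.differentiableAt.continuousAt

theorem IsTransition.surjective_fderiv (hh : IsTransition c d z h) :
    Function.Surjective (fderiv ℂ h z) :=
  LinearMap.injective_iff_surjective.1 hh.inj

theorem IsTransition.comp (hk : IsTransition d e (h z) k) (hh : IsTransition c d z h) :
    IsTransition c e z (k ∘ h) where
  mem_U := hh.mem_U
  holo := (hh.tendsto.eventually hk.holo).mp (hh.holo.mono fun w h1 h2 => h2.comp w h1)
  mem := hh.tendsto.eventually hk.mem
  proj := (hh.tendsto.eventually hk.proj).mp (hh.proj.mono fun _ h1 h2 => h2.trans h1)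
  inj := by
    rw [fderiv_comp z hk.differentiableAt hh.differentiableAt]
    exact hk.inj.comp hh.inj

theorem IsTransition.eventually (hh : IsTransition c d z h) :
    ∀ᶠ w in 𝓝 z, IsTransition c d w h := by
  filter_upwards [c.isOpen_U.mem_nhds hh.mem_U, eventually_injective_fderiv hh.holo hh.inj,
    hh.holo.eventually_nhds, hh.mem.eventually_nhds, hh.proj.eventually_nhds] with w h1 h2 h3 h4 h5
    using ⟨h1, h3, h4, h5, h2⟩

theorem IsTransition.eventually_mem_pre_iff (hh : IsTransition c d z h) :
    ∀ᶠ w in 𝓝 z, h w ∈ d.pre D ↔ w ∈ c.pre D := by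
  filter_upwards [c.isOpen_U.mem_nhds hh.mem_U, hh.mem, hh.proj] with w h1 h2 h3
  simp [OrbChart.pre, h1, h2, h3]

theorem IsTransition.mem_pre_iff (hh : IsTransition c d z h) : h z ∈ d.pre D ↔ z ∈ c.pre D :=
  hh.eventually_mem_pre_iff.self_of_nhds

theorem IsTransition.tendsto_diff (hh : IsTransition c d z h) :
    Tendsto h (𝓝[c.U \ c.pre D] z) (𝓝[d.U \ d.pre D] (h z)) := by
  refine tendsto_nhdsWithin_iff.2 ⟨hh.tendsto.mono_left nhdsWithin_le_nhds, ?_⟩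
  filter_upwards [self_mem_nhdsWithin, nhdsWithin_le_nhds hh.mem,
    nhdsWithin_le_nhds (hh.eventually_mem_pre_iff (D := D))] with w h1 h2 h3
    using ⟨h2, fun h => h1.2 (h3.1 h)⟩

theorem IsTransition.exists_inverse (hh : IsTransition c d z h) :
    ∃ k, IsTransition d c (h z) k ∧ k ∘ h =ᶠ[𝓝 z] id := by
  obtain ⟨e, he, hz, hsymm⟩ := exists_openPartialHomeomorph_of_injective_fderiv hh.holo hh.inj
  subst he
  have hinv : e.symm ∘ e =ᶠ[𝓝 z] id := e.eventually_left_inverse hz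
  have hinv' : e ∘ e.symm =ᶠ[𝓝 (e z)] id := e.eventually_right_inverse' hz
  have htendsto : Tendsto e.symm (𝓝 (e z)) (𝓝 z) := e.tendsto_symm hz
  refine ⟨e.symm, ⟨hh.mem.self_of_nhds, hsymm,
    htendsto.eventually (c.isOpen_U.mem_nhds hh.mem_U), ?_, ?_⟩, hinv⟩
  · filter_upwards [hinv', htendsto.eventually hh.proj] with w h1 h2
    exact h2.symm.trans (congrArg d.proj h1)
  · have hcomp : (fderiv ℂ e (e.symm (e z))).comp (fderiv ℂ e.symm (e z)) = .id ℂ _ := by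
      rw [← fderiv_comp _ _ hsymm.self_of_nhds, hinv'.fderiv_eq, fderiv_id]
      rw [e.left_inv hz]
      exact hh.differentiableAt
    exact Function.LeftInverse.injective fun v => DFunLike.congr_fun hcomp v

theorem IsTransition.fderiv_mem_tangentTo_iff (hh : IsTransition c d z h) :
    fderiv ℂ h z v ∈ tangentTo (d.pre D) (h z) ↔ v ∈ tangentTo (c.pre D) z := by
  refine ⟨fun hv => ?_,
    fderiv_mem_tangentTo hh.holo (hh.eventually_mem_pre_iff.mono fun _ h => h.2)⟩
  obtain ⟨k, hk, hkh⟩ := hh.exists_inverse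
  have := fderiv_mem_tangentTo hk.holo (hk.eventually_mem_pre_iff.mono fun _ h => h.2) hv
  rw [← ContinuousLinearMap.comp_apply, ← fderiv_comp z hk.differentiableAt hh.differentiableAt,
    hkh.fderiv_eq, fderiv_id] at this
  have hkz : k (h z) = z := hkh.self_of_nhds
  rwa [hkz] at this

theorem IsInjection.comp (hg : IsInjection d e g) (hf : IsInjection c d f) :
    IsInjection c e (g ∘ f) where
  mapsTo := hg.mapsTo.comp hf.mapsTo
  holo := hg.holo.comp hf.holo hf.mapsTo
  injOn := hg.injOn.comp hf.injOn hf.mapsTo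
  immersion _ hz := ((hg.isTransition (hf.mapsTo hz)).comp (hf.isTransition hz)).inj
  proj_comp z hz := (hg.proj_comp _ (hf.mapsTo hz)).trans (hf.proj_comp z hz)

theorem IsInjection.exists_apply_eq (hf : IsInjection c d f) (hz : z ∈ c.U) (hw : w ∈ d.U)
    (h : d.proj w = c.proj z) : ∃ f', IsInjection c d f' ∧ f' z = w := by
  obtain ⟨γ, hγ, hγw⟩ := (d.proj_eq_iff (f z) (hf.mapsTo hz) w hw).1
    ((hf.proj_comp z hz).trans h.symm)
  exact ⟨γ ∘ f, (d.isInjection_of_mem hγ).comp hf, hγw⟩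

theorem IsOrbAtlas.exists_roof {A : Set (OrbChart X n)} (hA : IsOrbAtlas A) (hc : c ∈ A)
    (hd : d ∈ A) (hz : z ∈ c.U) (hw : w ∈ d.U) (h : c.proj z = d.proj w) :
    ∃ e ∈ A, ∃ y ∈ e.U, (∃ f, IsInjection e c f ∧ f y = z) ∧ ∃ g, IsInjection e d g ∧ g y = w := by
  obtain ⟨e, he, ⟨y, hy, hyz⟩, ⟨f, hf⟩, g, hg⟩ :=
    hA.compat c hc d hd (c.proj z) ⟨⟨z, hz, rfl⟩, ⟨w, hw, h.symm⟩⟩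
  exact ⟨e, he, y, hy, hf.exists_apply_eq hy hz hyz.symm, hg.exists_apply_eq hy hw (by rw [hyz, h])⟩

theorem IsOrbAtlas.exists_transition {A : Set (OrbChart X n)} (hA : IsOrbAtlas A) (hc : c ∈ A)
    (hd : d ∈ A) (hz : z ∈ c.U) (hw : w ∈ d.U) (hzw : c.proj z = d.proj w) :
    ∃ h, IsTransition c d z h ∧ h z = w := by
  obtain ⟨e, -, y, hy, ⟨f, hf, rfl⟩, g, hg, rfl⟩ := hA.exists_roof hc hd hz hw hzw
  obtain ⟨h, hh, hhf⟩ := (hf.isTransition hy).exists_inverse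
  have hfy : h (f y) = y := hhf.self_of_nhds
  exact ⟨g ∘ h, (hfy.symm ▸ hg.isTransition hy : IsTransition e d (h (f y)) g).comp hh,
    congrArg g hfy⟩

theorem IsTransition.eventuallyEq_of_isotropy_trivial (hh : IsTransition c d z h)
    (hk : IsTransition c d z k) (hhk : h z = k z) (hiso : ∀ γ ∈ d.Γ, γ (h z) = h z → γ = 1) :
    h =ᶠ[𝓝 z] k := by
  have := d.finite_Γ
  have hmoved : ∀ᶠ w in 𝓝 z, ∀ γ : d.Γ, γ.1 ≠ 1 → γ.1 (h w) ≠ k w := by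
    refine eventually_all.2 fun γ => ?_
    rcases eq_or_ne γ.1 1 with hγ | hγ
    · exact .of_forall fun w hne => absurd hγ hne
    have hγh : ContinuousAt (γ.1 ∘ h) z := ((d.act_holo γ.1 γ.2).differentiableAt
      (d.isOpen_U.mem_nhds hh.mem.self_of_nhds)).continuousAt.comp hh.tendsto
    have hne : γ.1 (h z) ≠ k z := fun h2 => hγ (hiso γ.1 γ.2 (h2.trans hhk.symm))
    exact ((hγh.ne_iff_eventually_ne hk.tendsto).1 hne).mono fun _ hw _ => hw
  filter_upwards [hmoved, hh.mem, hk.mem, hh.proj, hk.proj] with w h1 h2 h3 h4 h5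
  obtain ⟨γ, hγ, hγw⟩ := (d.proj_eq_iff _ h2 _ h3).1 (h4.trans h5.symm)
  obtain rfl : γ = 1 := by_contra fun hne => h1 ⟨γ, hγ⟩ hne hγw
  exact hγw

end Transition

/-! ### Alternating forms of top degree -/

section AlternatingForms

variable {K V : Type*} [Field K] [AddCommGroup V] [Module K V] {m : ℕ} {ℓ : Module.Dual K V} {v : V}

theorem linearIndependent_vecCons_of_ker {u : Fin m → V} (hv : ℓ v ≠ 0) (hu : ∀ i, ℓ (u i) = 0)
    (hli : LinearIndependent K u) :
    LinearIndependent K (Matrix.vecCons v u : Fin (m + 1) → V) := by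
  refine linearIndependent_finCons.2 ⟨hli, fun hmem => hv ?_⟩
  have hle : Submodule.span K (Set.range u) ≤ LinearMap.ker ℓ :=
    Submodule.span_le.2 (Set.range_subset_iff.2 hu)
  exact hle hmem

variable [FiniteDimensional K V]

theorem exists_linearIndependent_ker (hV : Module.finrank K V = m + 1) (hℓ : ℓ ≠ 0) :
    ∃ u : Fin m → V, (∀ i, ℓ (u i) = 0) ∧ LinearIndependent K u := by
  have hker : Module.finrank K (LinearMap.ker ℓ) = m := by
    have := Module.Dual.finrank_ker_add_one_of_ne_zero hℓ
    omega
  let b := Module.finBasisOfFinrankEq K (LinearMap.ker ℓ) hker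
  exact ⟨fun i => b i, fun i => (b i).2,
    b.linearIndependent.map' (LinearMap.ker ℓ).subtype (Submodule.ker_subtype _)⟩

theorem alternatingMap_apply_eq_zero_of_ker (hV : Module.finrank K V = m + 1) (hℓ : ℓ ≠ 0)
    (η : V [⋀^Fin (m + 1)]→ₗ[K] K) {u : Fin (m + 1) → V} (hu : ∀ i, ℓ (u i) = 0) : η u = 0 := by
  refine η.map_linearDependent u fun hli => ?_
  have hli' : LinearIndependent K fun i => (⟨u i, hu i⟩ : LinearMap.ker ℓ) :=
    LinearIndependent.of_comp (LinearMap.ker ℓ).subtype hli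
  have hcard := hli'.fintype_card_le_finrank
  have hker := Module.Dual.finrank_ker_add_one_of_ne_zero hℓ
  rw [Fintype.card_fin] at hcard
  omega

theorem alternatingMap_apply_ne_zero {ι : Type*} [Fintype ι]
    (hV : Fintype.card ι = Module.finrank K V) {η : V [⋀^ι]→ₗ[K] K} (hη : η ≠ 0) {u : ι → V}
    (hu : LinearIndependent K u) : η u ≠ 0 := by
  classical
  have hb := coe_basisOfLinearIndependentOfCardEqFinrank' u hu hV
  exact fun h0 => hη ((AlternatingMap.map_basis_eq_zero_iff _ η).1 (hb.symm ▸ h0))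

theorem alternatingMap_eq_smul {ι : Type*} [Fintype ι] (hV : Fintype.card ι = Module.finrank K V)
    (η : V [⋀^ι]→ₗ[K] K) {θ : V [⋀^ι]→ₗ[K] K} {u : ι → V} (hθ : θ u ≠ 0) :
    η = (η u / θ u) • θ := by
  have hu : LinearIndependent K u := not_not.1 (mt (θ.map_linearDependent u) hθ)
  by_contra hne
  refine alternatingMap_apply_ne_zero hV (sub_ne_zero.2 hne) hu ?_
  rw [AlternatingMap.sub_apply, AlternatingMap.smul_apply, smul_eq_mul, div_mul_cancel₀ _ hθ,
    sub_self]

theorem compContinuousLinearMap_ne_zero_of_surjective {𝕜 E F G ι : Type*} [Semiring 𝕜]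
    [AddCommMonoid E] [Module 𝕜 E] [TopologicalSpace E] [AddCommMonoid F] [Module 𝕜 F]
    [TopologicalSpace F] [AddCommMonoid G] [Module 𝕜 G] [TopologicalSpace G]
    {η : F [⋀^ι]→L[𝕜] G} (hη : η ≠ 0) {L : E →L[𝕜] F} (hL : Function.Surjective L) :
    η.compContinuousLinearMap L ≠ 0 := fun h0 =>
  hη <| ContinuousAlternatingMap.toAlternatingMap_injective <|
    AlternatingMap.compLinearMap_injective L.toLinearMap hL <|
      congrArg ContinuousAlternatingMap.toAlternatingMap h0

end AlternatingForms

/-! ### The residue of a volume form -/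

section Residue

open Filter

variable {X : Type u} [TopologicalSpace X] {m : ℕ} {O : ComplexOrbifold X (m + 1)} {D : Set X}
  {Ω : HolVolForm O D} {α : ℕ} {c d : O.atlas} {z : CSpace (m + 1)} {s t : CSpace (m + 1) → ℂ}
  {Ψ Ψ' : (CSpace (m + 1)) [⋀^Fin (m + 1)]→L[ℂ] ℂ} {f : CSpace (m + 1) → CSpace (m + 1)}

/-- `Ψ ≠ 0` is the leading coefficient of `φ^*Ω` at the point `z ∈ D̃` of the chart `c` with
respect to the local defining function `s`, that is, the value at `z` of the extension of
`s ^ α • φ^*Ω`. -/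
structure IsLeadingForm (Ω : HolVolForm O D) (α : ℕ) (c : O.atlas) (z : CSpace (m + 1))
    (s : CSpace (m + 1) → ℂ) (Ψ : (CSpace (m + 1)) [⋀^Fin (m + 1)]→L[ℂ] ℂ) : Prop where
  isLocalDefining : IsLocalDefining (c.1.pre D) s z
  tendsto : Tendsto (fun w => s w ^ α • Ω.form c w) (𝓝[c.1.U \ c.1.pre D] z) (𝓝 Ψ)
  ne_zero : Ψ ≠ 0

theorem HolVolForm.BlowsUpToOrder.exists_isLeadingForm (hΩ : Ω.BlowsUpToOrder α)
    (hz : z ∈ c.1.pre D) :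
    ∃ V, IsOpen V ∧ z ∈ V ∧ ∃ s, DifferentiableOn ℂ s V ∧
      ∃ Ψ : CSpace (m + 1) → (CSpace (m + 1)) [⋀^Fin (m + 1)]→L[ℂ] ℂ, DifferentiableOn ℂ Ψ V ∧
        ∀ w ∈ V, w ∈ c.1.pre D → IsLeadingForm Ω α c w s (Ψ w) := by
  obtain ⟨V, -, hV, hzV, s, hs, Ψ, hΨ, hΨ0, h⟩ := hΩ c z hz
  refine ⟨V, hV, hzV, s, hs.holo, Ψ, hΨ, fun w hw hwD =>
    ⟨hs.isLocalDefining hV hw hwD, ?_, hΨ0 w hw⟩⟩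
  have hΨw : Tendsto Ψ (𝓝[c.1.U \ c.1.pre D] w) (𝓝 (Ψ w)) :=
    (hΨ.differentiableAt (hV.mem_nhds hw)).continuousAt.mono_left nhdsWithin_le_nhds
  refine hΨw.congr' ?_
  filter_upwards [self_mem_nhdsWithin, nhdsWithin_le_nhds (hV.mem_nhds hw)] with y hy hyV
    using (h y ⟨hyV, hy.2⟩).symm

namespace IsLeadingForm

theorem mem_U (h : IsLeadingForm Ω α c z s Ψ) : z ∈ c.1.U := h.isLocalDefining.mem.1

theorem neBot (h : IsLeadingForm Ω α c z s Ψ) : (𝓝[c.1.U \ c.1.pre D] z).NeBot :=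
  h.isLocalDefining.neBot (c.1.isOpen_U.mem_nhds h.mem_U)

theorem unique (h : IsLeadingForm Ω α c z s Ψ) (h' : IsLeadingForm Ω α c z s Ψ') : Ψ = Ψ' :=
  have := h.neBot
  tendsto_nhds_unique h.tendsto h'.tendsto

theorem clearedForm_eq (h : IsLeadingForm Ω α c z s Ψ) : Ω.clearedForm α c s z = Ψ :=
  have := h.neBot
  h.tendsto.limUnder_eq

theorem exists_smul (h : IsLeadingForm Ω α c z s Ψ) (ht : IsLocalDefining (c.1.pre D) t z) :
    ∃ k : ℂ, k ≠ 0 ∧ fderiv ℂ t z = k • fderiv ℂ s z ∧ IsLeadingForm Ω α c z t (k ^ α • Ψ) := by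
  obtain ⟨k, hk, hderiv, hdiv⟩ := h.isLocalDefining.exists_tendsto_div ht
  refine ⟨k, hk, hderiv, ht, ?_, smul_ne_zero (pow_ne_zero _ hk) h.ne_zero⟩
  have hdiv' := hdiv.mono_left (nhdsWithin_mono z (Set.sdiff_subset_compl c.1.U (c.1.pre D)))
  refine ((hdiv'.pow α).smul h.tendsto).congr' ?_
  filter_upwards [self_mem_nhdsWithin, nhdsWithin_le_nhds h.isLocalDefining.zero_iff] with w hw hsw
  have hsw0 : s w ≠ 0 := fun h0 => hw.2 (hsw.1 h0)
  rw [smul_smul, ← mul_pow, div_mul_cancel₀ _ hsw0]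

theorem exists_apply_ne_zero (h : IsLeadingForm Ω α c z s Ψ) :
    ∃ (v : CSpace (m + 1)) (u : Fin m → CSpace (m + 1)), fderiv ℂ s z v = 1 ∧
      (∀ i, fderiv ℂ s z (u i) = 0) ∧
        ∀ w, fderiv ℂ s z w ≠ 0 → Ψ (Matrix.vecCons w u) ≠ 0 := by
  obtain ⟨v, hv⟩ := h.isLocalDefining.exists_fderiv_apply_eq_one
  obtain ⟨u, hu, hli⟩ := exists_linearIndependent_ker (m := m) (by simp)
    (ContinuousLinearMap.coe_injective.ne h.isLocalDefining.deriv_ne)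
  refine ⟨v, u, hv, hu, fun w hw => alternatingMap_apply_ne_zero (by simp)
    (ContinuousAlternatingMap.toAlternatingMap_injective.ne h.ne_zero)
    (linearIndependent_vecCons_of_ker hw hu hli)⟩

theorem apply_vecCons_eq (h : IsLeadingForm Ω α c z s Ψ) {v v' : CSpace (m + 1)}
    (hv : v - v' ∈ tangentTo (c.1.pre D) z) {u : Fin m → CSpace (m + 1)}
    (hu : ∀ i, u i ∈ tangentTo (c.1.pre D) z) :
    Ψ (Matrix.vecCons v u) = Ψ (Matrix.vecCons v' u) := by
  simp only [h.isLocalDefining.mem_tangentTo] at hv hu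
  have hsub : Ψ.curryLeft (v - v') u = 0 :=
    alternatingMap_apply_eq_zero_of_ker (by simp)
      (ContinuousLinearMap.coe_injective.ne h.isLocalDefining.deriv_ne) Ψ.toAlternatingMap
      (Fin.cases hv hu)
  rw [map_sub] at hsub
  exact sub_eq_zero.1 hsub

end IsLeadingForm

/-- The form `λ ^ (-α) • (Ψ ⌟ v)` with `λ = ds(v)`. For `v = λ ∂/∂s` this is
`λ ^ (1 - α) • (Ψ ⌟ ∂/∂s)`. -/
noncomputable def residueForm (α : ℕ) (s : CSpace (m + 1) → ℂ)
    (Ψ : (CSpace (m + 1)) [⋀^Fin (m + 1)]→L[ℂ] ℂ) (z v : CSpace (m + 1)) :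
    (CSpace (m + 1)) [⋀^Fin m]→L[ℂ] ℂ :=
  ((fderiv ℂ s z v) ^ α)⁻¹ • Ψ.curryLeft v

theorem residueForm_apply (v : CSpace (m + 1)) (u : Fin m → CSpace (m + 1)) :
    residueForm α s Ψ z v u = ((fderiv ℂ s z v) ^ α)⁻¹ * Ψ (Matrix.vecCons v u) := rfl

theorem residueForm_smul {a : ℂ} (ha : a ≠ 0) (v : CSpace (m + 1)) :
    residueForm α s Ψ z (a • v) = a ^ (1 - (α : ℤ)) • residueForm α s Ψ z v := by
  rw [residueForm, residueForm, map_smul, map_smul, smul_smul, smul_smul, smul_eq_mul, mul_pow,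
    mul_inv, zpow_sub₀ ha, zpow_one, zpow_natCast]
  congr 1
  ring

theorem IsLeadingForm.residueForm_apply_eq (h : IsLeadingForm Ω α c z s Ψ)
    (h' : IsLeadingForm Ω α c z t Ψ') {v v' : CSpace (m + 1)}
    (hv : v - v' ∈ tangentTo (c.1.pre D) z) {u : Fin m → CSpace (m + 1)}
    (hu : ∀ i, u i ∈ tangentTo (c.1.pre D) z) :
    residueForm α s Ψ z v u = residueForm α t Ψ' z v' u := by
  obtain ⟨k, hk, hderiv, hk'⟩ := h.exists_smul h'.isLocalDefining
  obtain rfl := h'.unique hk'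
  have hsv : fderiv ℂ s z v = fderiv ℂ s z v' :=
    sub_eq_zero.1 ((map_sub _ _ _).symm.trans (h.isLocalDefining.mem_tangentTo.1 hv))
  have htv' : fderiv ℂ t z v' = k * fderiv ℂ s z v' := by simp [hderiv]
  rw [residueForm_apply, residueForm_apply, hsv, h.apply_vecCons_eq hv hu, htv', mul_pow, mul_inv,
    ContinuousAlternatingMap.smul_apply, smul_eq_mul]
  field_simp

theorem IsLeadingForm.restrictForm_ne_zero (h : IsLeadingForm Ω α c z s Ψ) {v : CSpace (m + 1)}
    (hv : v ∉ tangentTo (c.1.pre D) z) : restrictForm c.1 D z (residueForm α s Ψ z v) ≠ 0 := by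
  rw [h.isLocalDefining.mem_tangentTo] at hv
  obtain ⟨-, u, -, hu, hΨ⟩ := h.exists_apply_ne_zero
  intro h0
  have hval : residueForm α s Ψ z v u = 0 :=
    have huT i : u i ∈ tangentTo (c.1.pre D) z := h.isLocalDefining.mem_tangentTo.2 (hu i)
    DFunLike.congr_fun h0 fun i => (⟨u i, huT i⟩ : tangentTo (c.1.pre D) z)
  rw [residueForm_apply] at hval
  exact mul_ne_zero (inv_ne_zero (pow_ne_zero _ hv)) (hΨ v hv) hval

theorem IsLeadingForm.pullback (hf : IsInjection c.1 d.1 f) (hz : z ∈ c.1.U)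
    (h : IsLeadingForm Ω α d (f z) s Ψ) :
    IsLeadingForm Ω α c z (s ∘ f) (Ψ.compContinuousLinearMap (fderiv ℂ f z)) where
  isLocalDefining := h.isLocalDefining.comp (hf.isTransition hz).holo (hf.immersion z hz)
    (hf.isTransition hz).eventually_mem_pre_iff
  tendsto := by
    have hform := h.tendsto.comp ((hf.isTransition hz).tendsto_diff (D := D))
    have hderiv : Tendsto (fun w => ContinuousAlternatingMap.compContinuousLinearMapCLM (F := ℂ)
        (ι := Fin (m + 1)) (fderiv ℂ f w)) (𝓝[c.1.U \ c.1.pre D] z)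
        (𝓝 (ContinuousAlternatingMap.compContinuousLinearMapCLM (fderiv ℂ f z))) :=
      (ContinuousAlternatingMap.continuous_compContinuousLinearMapCLM.tendsto _).comp
        ((differentiableAt_fderiv (hf.isTransition hz).holo).continuousAt.mono_left
          nhdsWithin_le_nhds)
    refine ((isBoundedBilinearMap_apply.continuous.tendsto (_, _)).comp
      (hderiv.prodMk_nhds hform)).congr' ?_
    filter_upwards [self_mem_nhdsWithin] with w hw
    rw [← Ω.invariant c d f hf w hw]
    rfl
  ne_zero :=
    compContinuousLinearMap_ne_zero_of_surjective h.ne_zero (hf.isTransition hz).surjective_fderiv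

end Residue

/-! ### The residue map -/

section ResidueMap

variable {X : Type u} [TopologicalSpace X] {m : ℕ} {O : ComplexOrbifold X (m + 1)} {D : Set X}
  {Ω : HolVolForm O D} {α : ℕ} {c d : O.atlas} {s : CSpace (m + 1) → ℂ}
  {Ψ : (CSpace (m + 1)) [⋀^Fin (m + 1)]→L[ℂ] ℂ} {f : CSpace (m + 1) → CSpace (m + 1)}

theorem NormalPt.notMem_of_vec_eq {c : OrbChart X (m + 1)} {p : NormalPt c D}
    {v : CSpace (m + 1)} (h : p.vec = Submodule.Quotient.mk v) :
    v ∉ tangentTo (c.pre D) p.pt := fun hv =>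
  p.ne_zero (h.trans ((Submodule.Quotient.mk_eq_zero _).2 hv))

theorem HolVolForm.BlowsUpToOrder.exists_form (hΩ : Ω.BlowsUpToOrder α) (p : NormalPt c.1 D) :
    ∃ η : tangentTo (c.1.pre D) p.pt [⋀^Fin m]→L[ℂ] ℂ, η ≠ 0 ∧ ∀ s Ψ v,
      IsLeadingForm Ω α c p.pt s Ψ → p.vec = Submodule.Quotient.mk v →
        η = restrictForm c.1 D p.pt (residueForm α s Ψ p.pt v) := by
  obtain ⟨V, -, hpV, s, -, Ψ, -, hΨ⟩ := hΩ.exists_isLeadingForm p.mem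
  have h := hΨ p.pt hpV p.mem
  obtain ⟨v, hv⟩ := Submodule.Quotient.mk_surjective _ p.vec
  refine ⟨_, h.restrictForm_ne_zero (NormalPt.notMem_of_vec_eq hv.symm),
    fun t Ψ' v' h' hv' => ContinuousAlternatingMap.ext fun u => ?_⟩
  exact h.residueForm_apply_eq h' ((Submodule.Quotient.eq _).1 (hv.trans hv')) fun i => (u i).2

/-- The lift of the residue map of `Ω` to a chart. -/
noncomputable def residueLift (hΩ : Ω.BlowsUpToOrder α) (c : O.atlas) (p : NormalPt c.1 D) :
    CanonPt c.1 D where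
  pt := p.pt
  mem := p.mem
  form := (hΩ.exists_form p).choose
  ne_zero := (hΩ.exists_form p).choose_spec.1

theorem residueLift_form (hΩ : Ω.BlowsUpToOrder α) {p : NormalPt c.1 D} {v : CSpace (m + 1)}
    (h : IsLeadingForm Ω α c p.pt s Ψ) (hv : p.vec = Submodule.Quotient.mk v) :
    (residueLift hΩ c p).form = restrictForm c.1 D p.pt (residueForm α s Ψ p.pt v) :=
  (hΩ.exists_form p).choose_spec.2 s Ψ v h hv

theorem residueLift_compat (hΩ : Ω.BlowsUpToOrder α) (hf : IsInjection c.1 d.1 f)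
    {p : NormalPt c.1 D} {q : NormalPt d.1 D} (h : NormalRel f p q) :
    CanonRel f (residueLift hΩ c p) (residueLift hΩ d q) := by
  obtain ⟨hq, v, hpv, hqv⟩ := h
  obtain ⟨V, -, hqV, s, -, Ψ, -, hΨ⟩ := hΩ.exists_isLeadingForm q.mem
  have hd := hΨ _ hqV q.mem
  generalize Ψ q.pt = Φ at hd
  have hsf : fderiv ℂ (s ∘ f) p.pt v = fderiv ℂ s q.pt (fderiv ℂ f p.pt v) := by
    rw [hq, fderiv_comp p.pt (hq ▸ hd.isLocalDefining.holo.self_of_nhds)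
      (hf.isTransition p.mem.1).differentiableAt]
    rfl
  refine ⟨hq, fun u u' huu' => ?_⟩
  rw [residueLift_form hΩ hd hqv,
    residueLift_form hΩ (IsLeadingForm.pullback hf p.mem.1 (hq ▸ hd)) hpv]
  change ((fderiv ℂ s q.pt _) ^ α)⁻¹ * Φ (Matrix.vecCons _ fun i => (u' i : CSpace (m + 1))) =
    ((fderiv ℂ (s ∘ f) p.pt v) ^ α)⁻¹ *
      Φ (fderiv ℂ f p.pt ∘ Matrix.vecCons v fun i => (u i : CSpace (m + 1)))
  rw [hsf]
  exact congrArg (_ * Φ ·) (funext (Fin.cases rfl huu'))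

/-- The residue map of a volume form that blows up to order `α`. -/
noncomputable def residueMap (hΩ : Ω.BlowsUpToOrder α) : NormalToCanonMap O D where
  toFun := Quot.map (fun p => ⟨p.1, residueLift hΩ p.1 p.2⟩)
    fun _ _ ⟨f, hf, h⟩ => ⟨f, hf, residueLift_compat hΩ hf h⟩
  lift := residueLift hΩ
  toFun_mk _ _ := rfl
  compat _ _ _ hf _ _ h := residueLift_compat hΩ hf h

end ResidueMap

/-! ### Coverings with a fixed number of sheets -/

section Covering

variable {E Y E' Y' : Type*} [TopologicalSpace E] [TopologicalSpace Y] [TopologicalSpace E']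
  [TopologicalSpace Y'] {f : E → Y} {g : E' → Y'} {k : ℕ}

/-- An unbranched covering map all of whose fibres have exactly `k` points. For `k = 0`, infinite
fibres are admitted, since `Nat.card` of an infinite type is `0`. -/
structure IsCoveringMapOfDegree (f : E → Y) (k : ℕ) : Prop where
  isCoveringMap : IsCoveringMap f
  card_fiber : ∀ y, Nat.card (f ⁻¹' {y}) = k

namespace IsCoveringMapOfDegree

theorem surjective (hf : IsCoveringMapOfDegree f k) (hk : k ≠ 0) : Function.Surjective f := by
  intro y
  have hne : Nat.card (f ⁻¹' {y}) ≠ 0 := hf.card_fiber y ▸ hk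
  obtain ⟨⟨x, hx⟩⟩ := (Nat.card_ne_zero.1 hne).1
  exact ⟨x, hx⟩

theorem of_homeomorph (hf : IsCoveringMapOfDegree f k) (e : E' ≃ₜ E) (e' : Y' ≃ₜ Y)
    (h : ∀ x, e' (g x) = f (e x)) : IsCoveringMapOfDegree g k where
  isCoveringMap := by
    rw [← IsCoveringMap.homeomorph_comp_iff e', show e' ∘ g = f ∘ e from funext h]
    exact hf.isCoveringMap.comp_homeomorph e
  card_fiber y := by
    have hfib : g ⁻¹' {y} = e ⁻¹' (f ⁻¹' {e' y}) := by
      ext x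
      simp [← h]
    rw [hfib, Nat.card_preimage_of_injective e.injective (by simp), hf.card_fiber]

theorem prodMap_id (A : Type*) [TopologicalSpace A] (hf : IsCoveringMapOfDegree f k) :
    IsCoveringMapOfDegree (Prod.map (id : A → A) f) k where
  isCoveringMap := by
    rintro ⟨a, y⟩
    obtain ⟨hI, U, hyU, hU, hfU, H, hH⟩ := hf.isCoveringMap y
    exact IsEvenlyCovered.to_isEvenlyCovered_preimage ⟨hI, Set.univ ×ˢ U, ⟨trivial, hyU⟩,
      isOpen_univ.prod hU, isOpen_univ.prod hfU,
      (Homeomorph.Set.prod Set.univ (f ⁻¹' U)).trans <| ((Homeomorph.refl _).prodCongr H).trans <|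
        (Homeomorph.prodAssoc _ _ _).symm.trans <|
          (Homeomorph.Set.prod Set.univ U).symm.prodCongr (Homeomorph.refl _),
      fun x => Prod.ext rfl (hH ⟨x.1.2, x.2.2⟩)⟩
  card_fiber := by
    rintro ⟨a, y⟩
    have hfib : Prod.mk a ⁻¹' (Prod.map id f ⁻¹' {(a, y)}) = f ⁻¹' {y} := by
      ext x
      simp
    rw [← hf.card_fiber y, ← hfib, Nat.card_preimage_of_injective (Prod.mk_right_injective a)]
    rintro ⟨b, x⟩ hx
    exact ⟨x, Prod.ext (congrArg Prod.fst hx).symm rfl⟩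

theorem of_restrictPreimage (hf : Continuous f)
    (h : ∀ y, ∃ B, IsOpen B ∧ y ∈ B ∧ IsCoveringMapOfDegree (B.restrictPreimage f) k) :
    IsCoveringMapOfDegree f k where
  isCoveringMap y := by
    obtain ⟨B, hB, hy, hfB⟩ := h y
    exact IsCoveringMapOn.of_isCoveringMap_restrictPreimage B hB (hB.preimage hf)
      hfB.isCoveringMap y hy
  card_fiber y := by
    obtain ⟨B, -, hy, hfB⟩ := h y
    have hfib : B.restrictPreimage f ⁻¹' {⟨y, hy⟩} = Subtype.val ⁻¹' (f ⁻¹' {y}) := by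
      ext x
      simp [Subtype.ext_iff]
    rw [← hfB.card_fiber ⟨y, hy⟩, hfib, Nat.card_preimage_of_injective Subtype.val_injective]
    rintro x rfl
    exact ⟨⟨x, hy⟩, rfl⟩

end IsCoveringMapOfDegree

theorem card_setOf_pow_eq {k : ℕ} (hk : k ≠ 0) {b : ℂ} (hb : b ≠ 0) :
    Nat.card {x : ℂ | x ^ k = b} = k := by
  classical
  have hprim := Complex.isPrimitiveRoot_exp k hk
  have hroots : {x : ℂ | x ^ k = b} = (Polynomial.nthRoots k b).toFinset := by
    ext x
    simp [Polynomial.mem_nthRoots (Nat.pos_of_ne_zero hk)]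
  rw [hroots, Nat.card_coe_set_eq, Set.ncard_coe_finset,
    Multiset.toFinset_card_of_nodup (hprim.nthRoots_nodup hb), hprim.card_nthRoots,
    if_pos (IsAlgClosed.exists_pow_nat_eq b (Nat.pos_of_ne_zero hk))]

theorem card_setOf_zpow_eq {n : ℤ} (hn : n ≠ 0) {b : ℂ} (hb : b ≠ 0) :
    Nat.card {x : ℂ | x ^ n = b} = n.natAbs := by
  obtain ⟨k, rfl | rfl⟩ := n.eq_nat_or_neg
  · simpa using card_setOf_pow_eq (by simpa using hn) hb
  · simpa [inv_eq_iff_eq_inv] using card_setOf_pow_eq (k := k) (by simpa using hn) (inv_ne_zero hb)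

theorem isCoveringMapOfDegree_zpow {n : ℤ} (hn : n ≠ 0) :
    IsCoveringMapOfDegree (fun x : {x : ℂ // x ≠ 0} =>
      (⟨x ^ n, zpow_ne_zero n x.2⟩ : {x : ℂ // x ≠ 0})) n.natAbs where
  isCoveringMap := isCoveringMap_zpow n (Int.cast_ne_zero.2 hn)
  card_fiber := by
    rintro ⟨b, hb⟩
    rw [← card_setOf_zpow_eq hn hb,
      ← Nat.card_preimage_of_injective (Subtype.val_injective (p := fun x : ℂ => x ≠ 0))]
    · simp [Set.preimage, Subtype.ext_iff]
    · rintro x rfl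
      exact ⟨⟨x, (zpow_ne_zero_iff hn).1 hb⟩, rfl⟩

end Covering

/-! ### Holomorphy and continuity of the residue map -/

theorem differentiableOn_curryLeft {P E : Type*} [NormedAddCommGroup P] [NormedSpace ℂ P]
    [NormedAddCommGroup E] [NormedSpace ℂ E] {n : ℕ} {Ψ : P → E [⋀^Fin (n + 1)]→L[ℂ] ℂ} {S : Set P}
    (hΨ : DifferentiableOn ℂ Ψ S) : DifferentiableOn ℂ (fun p => (Ψ p).curryLeft) S := by
  have hL := (ContinuousAlternatingMap.curryLeftLI (𝕜 := ℂ) (E := E) (F := ℂ)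
    (n := n)).toContinuousLinearMap.differentiable
  exact Differentiable.comp_differentiableOn (g := fun η => η.curryLeft) (by exact hL) hΨ

section Lift

open Topology

variable {X : Type u} [TopologicalSpace X] {m : ℕ} {O : ComplexOrbifold X (m + 1)} {D : Set X}
  {Ω : HolVolForm O D} {α : ℕ} {φ : NormalToCanonMap O D}

theorem NormalPt.ofVec_eq {c : OrbChart X (m + 1)} {p : NormalPt c D} {v : CSpace (m + 1)}
    (hv : p.vec = Submodule.Quotient.mk v) :
    NormalPt.ofVec ⟨(p.pt, v), p.mem, NormalPt.notMem_of_vec_eq hv⟩ = p := by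
  obtain ⟨pt, mem, vec, hvec⟩ := p
  obtain rfl : vec = Submodule.Quotient.mk v := hv
  rfl

theorem CanonPt.ofForm_eq {c : OrbChart X (m + 1)} {y : CanonPt c D}
    {η : CSpace (m + 1) [⋀^Fin m]→L[ℂ] ℂ} (hη : y.form = restrictForm c D y.pt η) :
    CanonPt.ofForm ⟨(y.pt, η), y.mem, hη ▸ y.ne_zero⟩ = y := by
  obtain ⟨pt, mem, form, hform⟩ := y
  obtain rfl : form = restrictForm c D pt η := hη
  rfl

theorem NormalPt.isCoinducing_ofVec (c : OrbChart X (m + 1)) (D : Set X) :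
    IsCoinducing (NormalPt.ofVec (c := c) (D := D)) := ⟨rfl⟩

theorem CanonPt.isCoinducing_ofForm (c : OrbChart X (m + 1)) (D : Set X) :
    IsCoinducing (CanonPt.ofForm (c := c) (D := D)) := ⟨rfl⟩

theorem NormalPt.continuous_pt (c : OrbChart X (m + 1)) (D : Set X) :
    Continuous (NormalPt.pt (c := c) (D := D)) :=
  continuous_coinduced_dom.2 (continuous_fst.comp continuous_subtype_val)

theorem CanonPt.continuous_pt (c : OrbChart X (m + 1)) (D : Set X) :
    Continuous (CanonPt.pt (c := c) (D := D)) :=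
  continuous_coinduced_dom.2 (continuous_fst.comp continuous_subtype_val)

theorem differentiableOn_residueForm {V : Set (CSpace (m + 1))} (hV : IsOpen V)
    {s : CSpace (m + 1) → ℂ} (hs : DifferentiableOn ℂ s V)
    {Ψ : CSpace (m + 1) → (CSpace (m + 1)) [⋀^Fin (m + 1)]→L[ℂ] ℂ} (hΨ : DifferentiableOn ℂ Ψ V) :
    DifferentiableOn ℂ (fun p : CSpace (m + 1) × CSpace (m + 1) =>
      residueForm α s (Ψ p.1) p.1 p.2) {p | p.1 ∈ V ∧ fderiv ℂ s p.1 p.2 ≠ 0} := by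
  have hfst : DifferentiableOn ℂ Prod.fst
      {p : CSpace (m + 1) × CSpace (m + 1) | p.1 ∈ V ∧ fderiv ℂ s p.1 p.2 ≠ 0} :=
    differentiableOn_fst
  refine DifferentiableOn.smul (((((differentiableOn_fderiv hV hs).comp hfst fun p hp =>
    hp.1).clm_apply differentiableOn_snd).pow α).inv fun p hp => pow_ne_zero _ hp.2) ?_
  have hcurry : DifferentiableOn ℂ (fun p : CSpace (m + 1) × CSpace (m + 1) => (Ψ p.1).curryLeft)
      {p | p.1 ∈ V ∧ fderiv ℂ s p.1 p.2 ≠ 0} :=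
    differentiableOn_curryLeft (hΨ.comp hfst fun p hp => hp.1)
  exact hcurry.clm_apply differentiableOn_snd

theorem residueMap_isHolomorphic (hΩ : Ω.BlowsUpToOrder α) : (residueMap hΩ).IsHolomorphic := by
  intro c z v hz hv
  obtain ⟨V, hV, hzV, s, hs, Ψ, hΨ, hlead⟩ := hΩ.exists_isLeadingForm hz
  have hds : ContinuousOn (fun p : CSpace (m + 1) × CSpace (m + 1) => fderiv ℂ s p.1 p.2)
      (V ×ˢ Set.univ) :=
    ((differentiableOn_fderiv hV hs).continuousOn.comp continuousOn_fst fun p hp =>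
      hp.1).clm_apply continuousOn_snd
  have hopen : IsOpen {p : CSpace (m + 1) × CSpace (m + 1) | p.1 ∈ V ∧ fderiv ℂ s p.1 p.2 ≠ 0} := by
    convert hds.isOpen_inter_preimage (hV.prod isOpen_univ) (isOpen_compl_singleton (x := 0))
      using 1
    ext p
    simp
  have hzv : fderiv ℂ s z v ≠ 0 := fun h => hv ((hlead z hzV hz).isLocalDefining.mem_tangentTo.2 h)
  refine ⟨_, hopen, ⟨hzV, hzv⟩, fun p => (p.1, residueForm α s (Ψ p.1) p.1 p.2),
    differentiableOn_fst.prodMk (differentiableOn_residueForm hV hs hΨ), fun p hp => ?_⟩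
  have hp' := hlead p.1.1 hp.1 p.2.1
  exact ⟨⟨p.2.1, hp'.restrictForm_ne_zero p.2.2⟩,
    (CanonPt.ofForm_eq (y := residueLift hΩ c (NormalPt.ofVec p))
      (residueLift_form hΩ hp' rfl)).symm⟩

theorem NormalToCanonMap.IsHolomorphic.continuous_lift (h : φ.IsHolomorphic) (c : O.atlas) :
    Continuous (φ.lift c) := by
  refine continuous_coinduced_dom.2
    (continuous_iff_continuousAt.2 fun p => ?_)
  obtain ⟨W, hW, hpW, F, hF, hFl⟩ := h c p.1.1 p.1.2 p.2.1 p.2.2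
  refine ContinuousOn.continuousAt (s := Subtype.val ⁻¹' W) ?_
    ((hW.preimage continuous_subtype_val).mem_nhds hpW)
  rw [continuousOn_iff_continuous_domRestrict]
  have heq : Set.domRestrict (Subtype.val ⁻¹' W) (φ.lift c ∘ NormalPt.ofVec) =
      fun q => CanonPt.ofForm ⟨F q.1.1, (hFl q.1 q.2).choose⟩ :=
    funext fun q => (hFl q.1 q.2).choose_spec
  rw [heq]
  exact (CanonPt.isCoinducing_ofForm c.1 D).continuous.comp <| Continuous.subtype_mk
    (hF.continuousOn.comp_continuous (continuous_subtype_val.comp continuous_subtype_val)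
      fun q => q.2) _

theorem NormalToCanonMap.IsHolomorphic.continuous_toFun (h : φ.IsHolomorphic) :
    Continuous φ.toFun := by
  refine continuous_coinduced_dom.2 (continuous_sigma fun c => ?_)
  have hmk : (φ.toFun ∘ Quot.mk _) ∘ Sigma.mk c = CanonTotal.mk O D c ∘ φ.lift c :=
    funext fun p => φ.toFun_mk c p
  change Continuous ((φ.toFun ∘ Quot.mk _) ∘ Sigma.mk c)
  rw [hmk]
  exact (continuous_quot_mk.comp continuous_sigmaMk).comp (h.continuous_lift c)

theorem NormalToCanonMap.surjective_toFun (h : ∀ c, Function.Surjective (φ.lift c)) :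
    Function.Surjective φ.toFun := by
  rintro ⟨c, y⟩
  obtain ⟨p, rfl⟩ := h c y
  exact ⟨NormalTotal.mk O D c p, φ.toFun_mk c p⟩

end Lift

/-! ### Local trivialisations and the covering property -/

section LocalFrame

open Topology

variable {X : Type u} [TopologicalSpace X] {m : ℕ} {O : ComplexOrbifold X (m + 1)} {D : Set X}
  {Ω : HolVolForm O D} {α : ℕ} {c : O.atlas} {z : CSpace (m + 1)} {V : Set (CSpace (m + 1))}
  {s : CSpace (m + 1) → ℂ} {Ψ : CSpace (m + 1) → (CSpace (m + 1)) [⋀^Fin (m + 1)]→L[ℂ] ℂ}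
  {v : CSpace (m + 1)} {τ : CSpace (m + 1) → Fin m → CSpace (m + 1)}

/-- Near a point of `D̃`: a defining function `s`, the extension `Ψ` of `s ^ α • φ^*Ω`, a constant
vector field `v` transversal to the level sets of `s`, and a frame `τ` of the tangent spaces of the
level sets. The class of `v` trivialises `N_D̃` and its image under the residue map trivialises
`K_D̃`. -/
structure IsLocalFrame (Ω : HolVolForm O D) (α : ℕ) (c : O.atlas) (V : Set (CSpace (m + 1)))
    (s : CSpace (m + 1) → ℂ)
    (Ψ : CSpace (m + 1) → (CSpace (m + 1)) [⋀^Fin (m + 1)]→L[ℂ] ℂ)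
    (v : CSpace (m + 1)) (τ : CSpace (m + 1) → Fin m → CSpace (m + 1)) : Prop where
  isOpen : IsOpen V
  isLeadingForm : ∀ w ∈ V, w ∈ c.1.pre D → IsLeadingForm Ω α c w s (Ψ w)
  continuousOn_fderiv : ContinuousOn (fderiv ℂ s) V
  continuousOn_residueForm : ContinuousOn (fun w => residueForm α s (Ψ w) w v) V
  continuousOn_tangent : ContinuousOn τ V
  fderiv_apply_ne_zero : ∀ w ∈ V, fderiv ℂ s w v ≠ 0
  fderiv_tangent : ∀ w ∈ V, ∀ i, fderiv ℂ s w (τ w i) = 0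
  residueForm_ne_zero : ∀ w ∈ V, residueForm α s (Ψ w) w v (τ w) ≠ 0

theorem continuous_of_comp_isCoinducing {A B C : Type*} [TopologicalSpace A] [TopologicalSpace B]
    [TopologicalSpace C] {f : A → B} {g : B → C} (hf : IsCoinducing f) (hg : Continuous (g ∘ f)) :
    Continuous g :=
  ⟨fun _ hU => hf.isOpen_preimage.1 (hU.preimage hg)⟩

theorem HolVolForm.BlowsUpToOrder.exists_isLocalFrame (hΩ : Ω.BlowsUpToOrder α)
    (hz : z ∈ c.1.pre D) : ∃ V s Ψ v τ, z ∈ V ∧ IsLocalFrame Ω α c V s Ψ v τ := by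
  obtain ⟨V, hV, hzV, s, hs, Ψ, hΨ, hlead⟩ := hΩ.exists_isLeadingForm hz
  obtain ⟨v, u, hv, hu, huv⟩ := (hlead z hzV hz).exists_apply_ne_zero
  have hds : ContinuousOn (fderiv ℂ s) V := (differentiableOn_fderiv hV hs).continuousOn
  have hdsv : ContinuousOn (fun w => fderiv ℂ s w v) V := hds.clm_apply continuousOn_const
  have hV₁ : V ∩ (fun w => fderiv ℂ s w v) ⁻¹' {0}ᶜ ⊆ V := Set.inter_subset_left
  have hV₁o := hdsv.isOpen_inter_preimage hV (isOpen_compl_singleton (x := 0))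
  set V₁ := V ∩ (fun w => fderiv ℂ s w v) ⁻¹' {0}ᶜ
  let τ : CSpace (m + 1) → Fin m → CSpace (m + 1) :=
    fun w i => u i - (fderiv ℂ s w (u i) / fderiv ℂ s w v) • v
  have hτ : ContinuousOn τ V₁ := continuousOn_pi.2 fun i => continuousOn_const.sub <|
    (((hds.mono hV₁).clm_apply continuousOn_const).div (hdsv.mono hV₁) fun w hw =>
      hw.2).smul continuousOn_const
  have hτz : τ z = u := funext fun i => by simp [τ, hu i]
  have hη : ContinuousOn (fun w => residueForm α s (Ψ w) w v) V₁ :=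
    (differentiableOn_residueForm hV hs hΨ).continuousOn.comp (f := fun w => (w, v))
      (continuous_id.prodMk continuous_const).continuousOn fun w hw => hw
  have hητ : ContinuousOn (fun w => residueForm α s (Ψ w) w v (τ w)) V₁ := hη.eval hτ
  refine ⟨V₁ ∩ (fun w => residueForm α s (Ψ w) w v (τ w)) ⁻¹' {0}ᶜ, s, Ψ, v, τ,
    ⟨⟨hzV, by simp [hv]⟩, ?_⟩, hητ.isOpen_inter_preimage hV₁o isOpen_compl_singleton,
    fun w hw => hlead w hw.1.1, hds.mono fun w hw => hw.1.1, hη.mono Set.inter_subset_left,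
    hτ.mono Set.inter_subset_left, fun w hw => hw.1.2, fun w hw i => ?_, fun w hw => hw.2⟩
  · simpa [residueForm_apply, hv, hτz] using huv v (by simp [hv])
  · simp [τ, div_mul_cancel₀ _ hw.1.2]

/-- The linear form on the normal space `T_z Ũ / T_z S` induced by `ds`. -/
noncomputable def IsLocalDefining.conormal {n : ℕ} {S : Set (CSpace n)} {s : CSpace n → ℂ}
    {z : CSpace n} (hs : IsLocalDefining S s z) : (CSpace n ⧸ tangentTo S z) →ₗ[ℂ] ℂ :=
  (tangentTo S z).liftQ (fderiv ℂ s z).toLinearMap hs.tangentTo_eq.le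

theorem IsLocalDefining.conormal_injective {n : ℕ} {S : Set (CSpace n)} {s : CSpace n → ℂ}
    {z : CSpace n} (hs : IsLocalDefining S s z) : Function.Injective hs.conormal :=
  LinearMap.ker_eq_bot.1 (Submodule.ker_liftQ_eq_bot _ _ _ hs.tangentTo_eq.ge)

theorem IsLocalDefining.finrank_tangentTo {S : Set (CSpace (m + 1))} (hs : IsLocalDefining S s z) :
    Module.finrank ℂ (tangentTo S z) = m := by
  have hker := Module.Dual.finrank_ker_add_one_of_ne_zero
    (ContinuousLinearMap.coe_injective.ne hs.deriv_ne)
  rw [← hs.tangentTo_eq, Module.finrank_fin_fun] at hker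
  exact Nat.succ_injective hker

namespace IsLocalFrame

variable (h : IsLocalFrame Ω α c V s Ψ v τ)

include h

theorem isLocalDefining (hz : z ∈ V) (hzD : z ∈ c.1.pre D) : IsLocalDefining (c.1.pre D) s z :=
  (h.isLeadingForm z hz hzD).isLocalDefining

theorem smul_notMem_tangentTo (hz : z ∈ V) (hzD : z ∈ c.1.pre D) {a : ℂ} (ha : a ≠ 0) :
    a • v ∉ tangentTo (c.1.pre D) z := by
  rw [(h.isLocalDefining hz hzD).mem_tangentTo, map_smul]
  exact smul_ne_zero ha (h.fderiv_apply_ne_zero z hz)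

theorem tangent_mem_tangentTo (hz : z ∈ V) (hzD : z ∈ c.1.pre D) (i : Fin m) :
    τ z i ∈ tangentTo (c.1.pre D) z :=
  (h.isLocalDefining hz hzD).mem_tangentTo.2 (h.fderiv_tangent z hz i)

theorem smul_restrictForm_ne_zero (hz : z ∈ V) (hzD : z ∈ c.1.pre D) {a : ℂ} (ha : a ≠ 0) :
    restrictForm c.1 D z (a • residueForm α s (Ψ z) z v) ≠ 0 := fun h0 => by
  have hval : a • residueForm α s (Ψ z) z v (τ z) = 0 :=
    DFunLike.congr_fun h0 fun i =>
      (⟨τ z i, h.tangent_mem_tangentTo hz hzD i⟩ : tangentTo (c.1.pre D) z)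
  exact smul_ne_zero ha (h.residueForm_ne_zero z hz) hval

/-- The coordinate `λ` of the normal vector `λ [v]`. -/
noncomputable def normalCoord (p : (NormalPt.pt ⁻¹' V : Set (NormalPt c.1 D))) : ℂ :=
  (h.isLocalDefining p.2 p.1.mem).conormal p.1.vec / fderiv ℂ s p.1.pt v

theorem normalCoord_smul (p : (NormalPt.pt ⁻¹' V : Set (NormalPt c.1 D))) :
    p.1.vec = Submodule.Quotient.mk (h.normalCoord p • v) := by
  refine (h.isLocalDefining p.2 p.1.mem).conormal_injective ?_
  change _ = fderiv ℂ s p.1.pt (_ • v)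
  rw [map_smul, normalCoord, smul_eq_mul, div_mul_cancel₀ _ (h.fderiv_apply_ne_zero _ p.2)]

theorem normalCoord_ne_zero (p : (NormalPt.pt ⁻¹' V : Set (NormalPt c.1 D))) :
    h.normalCoord p ≠ 0 := fun h0 =>
  p.1.ne_zero (by rw [h.normalCoord_smul p, h0, zero_smul, Submodule.Quotient.mk_zero])

theorem continuous_normalCoord : Continuous h.normalCoord := by
  have hV := h.isOpen.preimage (NormalPt.continuous_pt c.1 D)
  refine continuous_of_comp_isCoinducing
    ((NormalPt.isCoinducing_ofVec c.1 D).restrictPreimage_of_isOpen hV) ?_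
  let q := fun q : NormalPt.ofVec ⁻¹' (NormalPt.pt ⁻¹' V : Set (NormalPt c.1 D)) => q.1.1
  have hq : Continuous q := continuous_subtype_val.comp continuous_subtype_val
  have hds : Continuous fun p => fderiv ℂ s (q p).1 :=
    h.continuousOn_fderiv.comp_continuous (continuous_fst.comp hq) fun p => p.2
  exact (hds.clm_apply (continuous_snd.comp hq)).div (hds.clm_apply continuous_const) fun p =>
    h.fderiv_apply_ne_zero _ p.2

/-- The coordinate `μ` of the form `μ • η`, where `η` is the image of `[v]` under the residue
map. -/
noncomputable def canonCoord (y : (CanonPt.pt ⁻¹' V : Set (CanonPt c.1 D))) : ℂ :=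
  y.1.form (fun i => ⟨τ y.1.pt i, h.tangent_mem_tangentTo y.2 y.1.mem i⟩) /
    residueForm α s (Ψ y.1.pt) y.1.pt v (τ y.1.pt)

theorem canonCoord_smul (y : (CanonPt.pt ⁻¹' V : Set (CanonPt c.1 D))) :
    y.1.form = restrictForm c.1 D y.1.pt
      (h.canonCoord y • residueForm α s (Ψ y.1.pt) y.1.pt v) := by
  have hcard : Fintype.card (Fin m) = Module.finrank ℂ (tangentTo (c.1.pre D) y.1.pt) := by
    rw [(h.isLocalDefining y.2 y.1.mem).finrank_tangentTo, Fintype.card_fin]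
  exact ContinuousAlternatingMap.toAlternatingMap_injective <|
    alternatingMap_eq_smul hcard y.1.form.toAlternatingMap
      (θ := (restrictForm c.1 D y.1.pt (residueForm α s (Ψ y.1.pt) y.1.pt v)).toAlternatingMap)
      (h.residueForm_ne_zero y.1.pt y.2)

theorem canonCoord_ne_zero (y : (CanonPt.pt ⁻¹' V : Set (CanonPt c.1 D))) :
    h.canonCoord y ≠ 0 := fun h0 =>
  y.1.ne_zero <| (h.canonCoord_smul y).trans <| by
    rw [h0]
    exact congrArg (restrictForm c.1 D y.1.pt) (zero_smul ℂ (residueForm α s (Ψ y.1.pt) y.1.pt v))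

theorem continuous_canonCoord : Continuous h.canonCoord := by
  have hV := h.isOpen.preimage (CanonPt.continuous_pt c.1 D)
  refine continuous_of_comp_isCoinducing
    ((CanonPt.isCoinducing_ofForm c.1 D).restrictPreimage_of_isOpen hV) ?_
  let q := fun q : CanonPt.ofForm ⁻¹' (CanonPt.pt ⁻¹' V : Set (CanonPt c.1 D)) => q.1.1
  have hq : Continuous q := continuous_subtype_val.comp continuous_subtype_val
  have hτ : Continuous fun p => τ (q p).1 :=
    h.continuousOn_tangent.comp_continuous (continuous_fst.comp hq) fun p => p.2
  have hη : Continuous fun p => residueForm α s (Ψ (q p).1) (q p).1 v :=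
    h.continuousOn_residueForm.comp_continuous (continuous_fst.comp hq) fun p => p.2
  exact ((continuous_snd.comp hq).eval hτ).div (hη.eval hτ) fun p => h.residueForm_ne_zero _ p.2

/-- The trivialisation of `N_D̃ \ {0}` given by the section `[v]`. -/
noncomputable def normalTriv :
    (NormalPt.pt ⁻¹' V : Set (NormalPt c.1 D)) ≃ₜ ↥(V ∩ c.1.pre D) × {x : ℂ // x ≠ 0} where
  toFun p := (⟨p.1.pt, p.2, p.1.mem⟩, ⟨h.normalCoord p, h.normalCoord_ne_zero p⟩)
  invFun q := ⟨NormalPt.ofVec ⟨(q.1.1, q.2.1 • v), q.1.2.2,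
    h.smul_notMem_tangentTo q.1.2.1 q.1.2.2 q.2.2⟩, q.1.2.1⟩
  left_inv p := Subtype.ext (NormalPt.ofVec_eq (h.normalCoord_smul p))
  right_inv q := by
    refine Prod.ext rfl (Subtype.ext ?_)
    change fderiv ℂ s q.1.1 (q.2.1 • v) / fderiv ℂ s q.1.1 v = q.2.1
    rw [map_smul, smul_eq_mul, mul_div_cancel_right₀ _ (h.fderiv_apply_ne_zero _ q.1.2.1)]
  continuous_toFun :=
    (((NormalPt.continuous_pt c.1 D).comp continuous_subtype_val).subtype_mk _).prodMk
      (h.continuous_normalCoord.subtype_mk _)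
  continuous_invFun := by
    have hfst : Continuous fun q : ↥(V ∩ c.1.pre D) × {x : ℂ // x ≠ 0} => q.1.1 :=
      continuous_subtype_val.comp continuous_fst
    have hsnd : Continuous fun q : ↥(V ∩ c.1.pre D) × {x : ℂ // x ≠ 0} => q.2.1 :=
      continuous_subtype_val.comp continuous_snd
    exact ((NormalPt.isCoinducing_ofVec c.1 D).continuous.comp
      ((hfst.prodMk (hsnd.smul continuous_const)).subtype_mk _)).subtype_mk _

/-- The trivialisation of `K_D̃ \ {0}` given by the image of `[v]` under the residue map. -/
noncomputable def canonTriv :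
    (CanonPt.pt ⁻¹' V : Set (CanonPt c.1 D)) ≃ₜ ↥(V ∩ c.1.pre D) × {x : ℂ // x ≠ 0} where
  toFun y := (⟨y.1.pt, y.2, y.1.mem⟩, ⟨h.canonCoord y, h.canonCoord_ne_zero y⟩)
  invFun q := ⟨CanonPt.ofForm ⟨(q.1.1, q.2.1 • residueForm α s (Ψ q.1.1) q.1.1 v), q.1.2.2,
    h.smul_restrictForm_ne_zero q.1.2.1 q.1.2.2 q.2.2⟩, q.1.2.1⟩
  left_inv y := Subtype.ext (CanonPt.ofForm_eq (h.canonCoord_smul y))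
  right_inv q := Prod.ext rfl <| Subtype.ext <|
    mul_div_cancel_right₀ q.2.1 (h.residueForm_ne_zero _ q.1.2.1)
  continuous_toFun :=
    (((CanonPt.continuous_pt c.1 D).comp continuous_subtype_val).subtype_mk _).prodMk
      (h.continuous_canonCoord.subtype_mk _)
  continuous_invFun := by
    have hfst : Continuous fun q : ↥(V ∩ c.1.pre D) × {x : ℂ // x ≠ 0} => q.1.1 :=
      continuous_subtype_val.comp continuous_fst
    have hsnd : Continuous fun q : ↥(V ∩ c.1.pre D) × {x : ℂ // x ≠ 0} => q.2.1 :=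
      continuous_subtype_val.comp continuous_snd
    have hη := h.continuousOn_residueForm.comp_continuous hfst fun q => q.1.2.1
    exact ((CanonPt.isCoinducing_ofForm c.1 D).continuous.comp
      ((hfst.prodMk (hsnd.smul hη)).subtype_mk _)).subtype_mk _

theorem canonTriv_residueLift (hΩ : Ω.BlowsUpToOrder α)
    (p : (NormalPt.pt ⁻¹' V : Set (NormalPt c.1 D))) :
    h.canonTriv ⟨residueLift hΩ c p.1, p.2⟩ = Prod.map id
      (fun x : {x : ℂ // x ≠ 0} => (⟨x ^ (1 - (α : ℤ)), zpow_ne_zero _ x.2⟩ : {x : ℂ // x ≠ 0}))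
      (h.normalTriv p) := by
  have hp := h.isLeadingForm p.1.pt p.2 p.1.mem
  refine Prod.ext rfl (Subtype.ext ?_)
  change (residueLift hΩ c p.1).form _ / _ = h.normalCoord p ^ (1 - (α : ℤ))
  rw [residueLift_form hΩ hp (h.normalCoord_smul p), residueForm_smul (h.normalCoord_ne_zero p)]
  exact mul_div_cancel_right₀ _ (h.residueForm_ne_zero _ p.2)

theorem isCoveringMapOfDegree_restrictPreimage (hΩ : Ω.BlowsUpToOrder α) (hα : 2 ≤ α) :
    IsCoveringMapOfDegree ((CanonPt.pt ⁻¹' V).restrictPreimage (residueLift hΩ c)) (α - 1) := by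
  have hdeg : (1 - (α : ℤ)).natAbs = α - 1 := by omega
  exact hdeg ▸ ((isCoveringMapOfDegree_zpow (by omega)).prodMap_id _).of_homeomorph
    h.normalTriv h.canonTriv (h.canonTriv_residueLift hΩ)

end IsLocalFrame

theorem residueLift_isCoveringMapOfDegree (hΩ : Ω.BlowsUpToOrder α) (hα : 2 ≤ α) (c : O.atlas) :
    IsCoveringMapOfDegree (residueLift hΩ c) (α - 1) := by
  refine .of_restrictPreimage ((residueMap_isHolomorphic hΩ).continuous_lift c) fun y => ?_
  obtain ⟨V, s, Ψ, v, τ, hyV, h⟩ := hΩ.exists_isLocalFrame y.mem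
  exact ⟨CanonPt.pt ⁻¹' V, h.isOpen.preimage (CanonPt.continuous_pt c.1 D), hyV,
    h.isCoveringMapOfDegree_restrictPreimage hΩ hα⟩

theorem residueMap_isUnbranchedCovering (hΩ : Ω.BlowsUpToOrder α) (hα : 2 ≤ α) :
    (residueMap hΩ).IsUnbranchedCovering (α - 1) :=
  have hcov := residueLift_isCoveringMapOfDegree hΩ hα
  ⟨(residueMap_isHolomorphic hΩ).continuous_toFun,
    NormalToCanonMap.surjective_toFun fun c => (hcov c).surjective (by omega),
    fun c => ⟨(hcov c).isCoveringMap, (hcov c).card_fiber⟩⟩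

end LocalFrame

/-! ### The residue formula and uniqueness -/

section ResidueFormula

variable {X : Type u} [TopologicalSpace X] {m : ℕ} {D : Set X} {α : ℕ}

theorem residueMap_isResidueMap {O : ComplexOrbifold X (m + 1)} {Ω : HolVolForm O D}
    (hΩ : Ω.BlowsUpToOrder α) : (residueMap hΩ).IsResidueMap Ω α := by
  intro c _ s hs p v lam hlam hv hvec
  obtain ⟨V, -, hpV, t, -, Ψ, -, hΨ⟩ := hΩ.exists_isLeadingForm p.mem
  obtain ⟨k, -, -, hlead⟩ := (hΨ p.pt hpV p.mem).exists_smul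
    (hs.isLocalDefining c.1.isOpen_U p.mem.1 p.mem)
  refine ⟨rfl, fun u => ?_⟩
  have hform := DFunLike.congr_fun (residueLift_form hΩ hlead (v := lam • v) hvec) u
  rw [residueForm_smul hlam] at hform
  rw [hlead.clearedForm_eq]
  refine hform.trans (congrArg (lam ^ (1 - (α : ℤ)) * ·) ?_)
  change residueForm α s _ p.pt v (fun i => (u i : CSpace (m + 1))) = _
  rw [residueForm_apply, hv, one_pow, inv_one, one_mul]

theorem OrbChart.IsAdapted.exists_isDefiningFunctionOn {c : OrbChart X (m + 1)}
    (h : c.IsAdapted D α) : ∃ s, IsDefiningFunctionOn (c.pre D) c.U s := by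
  obtain ⟨ζ, hζ, -, himm, hD, -⟩ := h
  refine ⟨fun w => ζ w (Fin.last m), differentiableOn_pi.1 hζ _, fun z hz => ?_,
    fun z hz _ h0 => ?_⟩
  · rw [← hD z hz]
    exact ⟨fun h => ⟨hz, h⟩, And.right⟩
  · have hd : DifferentiableAt ℂ ζ z := hζ.differentiableAt (c.isOpen_U.mem_nhds hz)
    obtain ⟨v, hv⟩ := LinearMap.injective_iff_surjective.1 (himm z hz) (Pi.single (Fin.last m) 1)
    have hlast := (hasFDerivAt_pi'.1 hd.hasFDerivAt (Fin.last m)).fderiv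
    have hone : fderiv ℂ ζ z v (Fin.last m) = 1 := by simpa using congrFun hv (Fin.last m)
    rw [h0] at hlast
    exact zero_ne_one ((DFunLike.congr_fun hlast v).trans hone)

theorem CanonPt.ext_of_apply {c : OrbChart X (m + 1)} {y y' : CanonPt c D} (h : y.pt = y'.pt)
    (hform : ∀ (u : Fin m → tangentTo (c.pre D) y.pt) (u' : Fin m → tangentTo (c.pre D) y'.pt),
      (∀ i, (u i : CSpace (m + 1)) = u' i) → y.form u = y'.form u') : y = y' := by
  obtain ⟨pt, mem, η, hη⟩ := y
  obtain ⟨pt', mem', η', hη'⟩ := y'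
  obtain rfl : pt = pt' := h
  obtain rfl : η = η' := ContinuousAlternatingMap.ext fun u => hform u u fun _ => rfl
  rfl

theorem NormalToCanonMap.IsResidueMap.lift_eq_of_isAdapted {O : ComplexOrbifold X (m + 1)}
    {Ω : HolVolForm O D} {φ ψ : NormalToCanonMap O D} (hφ : φ.IsResidueMap Ω α)
    (hψ : ψ.IsResidueMap Ω α) {c : O.atlas} (hc : c.1.IsAdapted D α) (p : NormalPt c.1 D) :
    φ.lift c p = ψ.lift c p := by
  obtain ⟨s, hs⟩ := hc.exists_isDefiningFunctionOn
  obtain ⟨v, hv⟩ := Submodule.Quotient.mk_surjective _ p.vec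
  have hloc := hs.isLocalDefining c.1.isOpen_U p.mem.1 p.mem
  have hlam : fderiv ℂ s p.pt v ≠ 0 :=
    hloc.mem_tangentTo.not.1 (NormalPt.notMem_of_vec_eq hv.symm)
  have hone : fderiv ℂ s p.pt ((fderiv ℂ s p.pt v)⁻¹ • v) = 1 := by
    rw [map_smul, smul_eq_mul, inv_mul_cancel₀ hlam]
  have hvec : p.vec = fderiv ℂ s p.pt v •
      (Submodule.Quotient.mk ((fderiv ℂ s p.pt v)⁻¹ • v) :
        CSpace (m + 1) ⧸ tangentTo (c.1.pre D) p.pt) := by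
    rw [← Submodule.Quotient.mk_smul, smul_inv_smul₀ hlam, hv]
  obtain ⟨hφpt, hφform⟩ := hφ c hc s hs p _ _ hlam hone hvec
  obtain ⟨hψpt, hψform⟩ := hψ c hc s hs p _ _ hlam hone hvec
  refine CanonPt.ext_of_apply (hφpt.trans hψpt.symm) fun u u' huu' => ?_
  simp only [hφform, hψform, huu']

section Gluing

variable {c d : OrbChart X (m + 1)} {f : CSpace (m + 1) → CSpace (m + 1)}

theorem CanonRel.left_unique (hf : IsInjection c d f) {y y' : CanonPt c D} {q : CanonPt d D}
    (h : CanonRel f y q) (h' : CanonRel f y' q) : y = y' := by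
  have hpt : y.pt = y'.pt := hf.injOn y.mem.1 y'.mem.1 (h.1.symm.trans h'.1)
  refine CanonPt.ext_of_apply hpt fun u u' huu' => ?_
  have hmem (i : Fin m) : fderiv ℂ f y.pt (u i) ∈ tangentTo (d.pre D) q.pt :=
    h.1 ▸ (hf.isTransition y.mem.1).fderiv_mem_tangentTo_iff.2 (u i).2
  exact (h.2 u (fun i => ⟨_, hmem i⟩) fun _ => rfl).symm.trans
    (h'.2 u' (fun i => ⟨_, hmem i⟩) fun i => by rw [← huu', ← hpt])

theorem CanonRel.right_unique (hf : IsInjection c d f) {y : CanonPt c D} {q q' : CanonPt d D}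
    (h : CanonRel f y q) (h' : CanonRel f y q') : q = q' := by
  refine CanonPt.ext_of_apply (h.1.trans h'.1.symm) fun u u' huu' => ?_
  have hy := hf.isTransition y.mem.1
  choose w hw using fun i => hy.surjective_fderiv (u i : CSpace (m + 1))
  have hmem (i : Fin m) : w i ∈ tangentTo (c.pre D) y.pt := by
    rw [← hy.fderiv_mem_tangentTo_iff, hw, ← h.1]
    exact (u i).2
  exact (h.2 (fun i => ⟨_, hmem i⟩) u fun i => (hw i).symm).trans
    (h'.2 (fun i => ⟨_, hmem i⟩) u' fun i => by rw [← huu', ← hw]).symm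

theorem exists_normalRel_left (hf : IsInjection c d f) {q : NormalPt d D} {z : CSpace (m + 1)}
    (hz : z ∈ c.U) (h : f z = q.pt) : ∃ p : NormalPt c D, NormalRel f p q := by
  have hfz := hf.isTransition hz
  obtain ⟨v', hv'⟩ := Submodule.Quotient.mk_surjective _ q.vec
  obtain ⟨v, hv⟩ := hfz.surjective_fderiv v'
  refine ⟨NormalPt.ofVec ⟨(z, v), hfz.mem_pre_iff.1 (h ▸ q.mem), ?_⟩, h.symm, v, rfl, ?_⟩
  · rw [← hfz.fderiv_mem_tangentTo_iff, hv, h]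
    exact NormalPt.notMem_of_vec_eq hv'.symm
  · exact hv'.symm.trans (congrArg _ hv.symm)

theorem exists_normalRel_right (hf : IsInjection c d f) (p : NormalPt c D) :
    ∃ q : NormalPt d D, NormalRel f p q := by
  have hfp := hf.isTransition p.mem.1
  obtain ⟨v, hv⟩ := Submodule.Quotient.mk_surjective _ p.vec
  exact ⟨NormalPt.ofVec ⟨(f p.pt, fderiv ℂ f p.pt v), hfp.mem_pre_iff.2 p.mem,
    hfp.fderiv_mem_tangentTo_iff.not.2 (NormalPt.notMem_of_vec_eq hv.symm)⟩, rfl, v, hv.symm, rfl⟩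

end Gluing

theorem NormalToCanonMap.ext_of_lift {O : ComplexOrbifold X (m + 1)} {φ ψ : NormalToCanonMap O D}
    (h : ∀ c p, φ.lift c p = ψ.lift c p) : φ = ψ := by
  obtain ⟨F, l, hF, hl⟩ := φ
  obtain ⟨G, k, hG, hk⟩ := ψ
  obtain rfl : l = k := funext fun c => funext (h c)
  obtain rfl : F = G := funext (Quot.ind fun p => (hF p.1 p.2).trans (hG p.1 p.2).symm)
  rfl

theorem NormalToCanonMap.IsResidueMap.unique {O : ComplexOrbifold X (m + 1)} {Ω : HolVolForm O D}
    (hbasic : O.BasicAssumption D α) {φ ψ : NormalToCanonMap O D} (hφ : φ.IsResidueMap Ω α)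
    (hψ : ψ.IsResidueMap Ω α) : φ = ψ := by
  refine NormalToCanonMap.ext_of_lift fun c p => ?_
  obtain ⟨d, hd, ⟨w, hw, hwp⟩, hadapted⟩ := hbasic _ p.mem.2
  obtain ⟨e, he, y, hy, ⟨f, hf, hfy⟩, g, hg, -⟩ :=
    O.isAtlas.exists_roof c.2 hd p.mem.1 hw hwp.symm
  lift e to O.atlas using he
  lift d to O.atlas using hd
  obtain ⟨r, hr⟩ := exists_normalRel_left hf hy hfy
  obtain ⟨q, hq⟩ := exists_normalRel_right hg r
  have hlift_q : φ.lift d q = ψ.lift d q := hφ.lift_eq_of_isAdapted hψ hadapted q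
  have hlift_r : φ.lift e r = ψ.lift e r :=
    CanonRel.left_unique hg (φ.compat e d g hg r q hq) (hlift_q ▸ ψ.compat e d g hg r q hq)
  exact CanonRel.right_unique hf (φ.compat e c f hf r p hr) (hlift_r ▸ ψ.compat e c f hf r p hr)

end ResidueFormula

/-! ### The volume form defined by an isomorphism `-K_X = α[D]` -/

section VolumeForms

open Filter

variable {X : Type u} [TopologicalSpace X] {m : ℕ} {O : ComplexOrbifold X (m + 1)} {D : Set X}
  {α : ℕ} {A : Set (OrbChart X (m + 1))} {c d : OrbChart X (m + 1)} {z : CSpace (m + 1)}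
  {h : CSpace (m + 1) → CSpace (m + 1)}
  {G : OrbChart X (m + 1) → CSpace (m + 1) → (CSpace (m + 1)) [⋀^Fin (m + 1)]→L[ℂ] ℂ}

theorem IsTransition.mem_diff (hh : IsTransition c d z h) (hz : z ∉ c.pre D) :
    h z ∈ d.U \ d.pre D :=
  ⟨hh.mem.self_of_nhds, hh.mem_pre_iff.not.2 hz⟩

theorem IsTransition.differentiableWithinAt_pullback {k : ℕ}
    {η : CSpace (m + 1) → (CSpace (m + 1)) [⋀^Fin k]→L[ℂ] ℂ} {S T : Set (CSpace (m + 1))}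
    (hh : IsTransition c d z h) (hη : DifferentiableWithinAt ℂ η T (h z))
    (hST : Tendsto h (𝓝[S] z) (𝓝[T] (h z))) :
    DifferentiableWithinAt ℂ
      (fun w => (η (h w)).compContinuousLinearMap (fderiv ℂ h w)) S z :=
  DifferentiableWithinAt.continuousAlternatingMapCompContinuousLinearMap
    (hη.hasFDerivWithinAt.comp_of_tendsto z hh.differentiableAt.hasFDerivAt.hasFDerivWithinAt
      hST).differentiableWithinAt
    (differentiableAt_fderiv hh.holo).differentiableWithinAt

theorem IsTransition.isDefiningFunctionOn_comp {V : Set (CSpace (m + 1))}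
    (hh : ∀ w ∈ V, IsTransition c d w h) {s : CSpace (m + 1) → ℂ}
    (hs : IsDefiningFunctionOn (d.pre D) d.U s) :
    IsDefiningFunctionOn (c.pre D) V (s ∘ h) where
  holo := hs.holo.comp (fun w hw => (hh w hw).differentiableAt.differentiableWithinAt)
    fun w hw => (hh w hw).mem.self_of_nhds
  zero_iff w hw := (hs.zero_iff _ (hh w hw).mem.self_of_nhds).trans (hh w hw).mem_pre_iff
  deriv_ne w hw hwD :=
    ((hs.isLocalDefining d.isOpen_U (hh w hw).mem.self_of_nhds
      ((hh w hw).mem_pre_iff.2 hwD)).comp (hh w hw).holo (hh w hw).inj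
        (hh w hw).eventually_mem_pre_iff).deriv_ne

theorem IsOrbAtlas.exists_mem_isTransition (hAO : A ⊆ O.atlas) (hA : IsOrbAtlas A)
    (hc : c ∈ O.atlas) (hz : z ∈ c.U) : ∃ d ∈ A, ∃ h, IsTransition c d z h := by
  obtain ⟨d, hd, w, hw, hwz⟩ := hA.cover (c.proj z)
  obtain ⟨h, hh, -⟩ := O.isAtlas.exists_transition hc (hAO hd) hz hw hwz.symm
  exact ⟨d, hd, h, hh⟩

/-- The forms `G` are holomorphic volume forms off `D` on the charts of the atlas `A`, compatible
with all injections. In contrast to `HolVolForm`, `A` need not be the full atlas of an orbifold. -/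
structure IsVolFormFamily (A : Set (OrbChart X (m + 1))) (D : Set X)
    (G : OrbChart X (m + 1) → CSpace (m + 1) → (CSpace (m + 1)) [⋀^Fin (m + 1)]→L[ℂ] ℂ) :
    Prop where
  holo : ∀ c ∈ A, DifferentiableOn ℂ (G c) (c.U \ c.pre D)
  ne_zero : ∀ c ∈ A, ∀ z ∈ c.U \ c.pre D, G c z ≠ 0
  invariant : ∀ c ∈ A, ∀ d ∈ A, ∀ f, IsInjection c d f → ∀ z ∈ c.U \ c.pre D,
    (G d (f z)).compContinuousLinearMap (fderiv ℂ f z) = G c z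

namespace IsVolFormFamily

theorem pullback_comp_eq (hG : IsVolFormFamily A D G) (hsing : O.singularSet ⊆ D)
    (hAO : A ⊆ O.atlas) (hz : z ∉ c.pre D) {e : OrbChart X (m + 1)} (he : e ∈ A) (hd : d ∈ A)
    {f k : CSpace (m + 1) → CSpace (m + 1)} (hk : IsTransition c e z k) (hf : IsInjection e d f)
    (hh : IsTransition c d z h) (hfk : f (k z) = h z) :
    (G d (h z)).compContinuousLinearMap (fderiv ℂ h z) =
      (G e (k z)).compContinuousLinearMap (fderiv ℂ k z) := by
  have hke := hk.mem_diff hz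
  have hfe := hf.isTransition hke.1
  have hhd := hh.mem_diff hz
  have hiso : ∀ γ ∈ d.Γ, γ (h z) = h z → γ = 1 := fun γ hγ hγh => by_contra fun hne =>
    hhd.2 ⟨hhd.1, hsing ⟨d, hAO hd, h z, hhd.1, rfl, γ, hγ, hne, hγh⟩⟩
  have hgerm : h =ᶠ[𝓝 z] f ∘ k :=
    hh.eventuallyEq_of_isotropy_trivial (hfe.comp hk) hfk.symm hiso
  rw [← hG.invariant e he d hd f hf _ hke, hfk, hgerm.fderiv_eq,
    fderiv_comp z hfe.differentiableAt hk.differentiableAt]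
  rfl

theorem pullback_eq (hG : IsVolFormFamily A D G) (hsing : O.singularSet ⊆ D)
    (hAO : A ⊆ O.atlas) (hA : IsOrbAtlas A) (hc : c ∈ O.atlas) (hz : z ∉ c.pre D)
    {d' : OrbChart X (m + 1)} {h' : CSpace (m + 1) → CSpace (m + 1)} (hd : d ∈ A) (hd' : d' ∈ A)
    (hh : IsTransition c d z h) (hh' : IsTransition c d' z h') :
    (G d (h z)).compContinuousLinearMap (fderiv ℂ h z) =
      (G d' (h' z)).compContinuousLinearMap (fderiv ℂ h' z) := by
  have hproj : d.proj (h z) = c.proj z := hh.proj.self_of_nhds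
  obtain ⟨e, he, y, hy, ⟨f, hf, hfy⟩, f', hf', hfy'⟩ := hA.exists_roof hd hd'
    hh.mem.self_of_nhds hh'.mem.self_of_nhds (hproj.trans hh'.proj.self_of_nhds.symm)
  have hzy : c.proj z = e.proj y := by rw [← hf.proj_comp y hy, hfy, hproj]
  obtain ⟨k, hk, rfl⟩ := O.isAtlas.exists_transition hc (hAO he) hh.mem_U hy hzy
  exact (hG.pullback_comp_eq hsing hAO hz he hd hk hf hh hfy).trans
    (hG.pullback_comp_eq hsing hAO hz he hd' hk hf' hh' hfy').symm

/-- The extension to all charts of an orbifold of a family of forms on the charts of an atlas `A`: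
the common value of all pullbacks under transitions to charts in `A`. Where these disagree, in
particular at points of `D̃`, the value is arbitrary. -/
noncomputable def extendForm (A : Set (OrbChart X (m + 1)))
    (G : OrbChart X (m + 1) → CSpace (m + 1) → (CSpace (m + 1)) [⋀^Fin (m + 1)]→L[ℂ] ℂ)
    (c : OrbChart X (m + 1)) (z : CSpace (m + 1)) : (CSpace (m + 1)) [⋀^Fin (m + 1)]→L[ℂ] ℂ :=
  Classical.epsilon fun η => ∀ d ∈ A, ∀ h, IsTransition c d z h →
    η = (G d (h z)).compContinuousLinearMap (fderiv ℂ h z)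

theorem extendForm_eq (hG : IsVolFormFamily A D G) (hsing : O.singularSet ⊆ D)
    (hAO : A ⊆ O.atlas) (hA : IsOrbAtlas A) (hc : c ∈ O.atlas) (hz : z ∉ c.pre D) (hd : d ∈ A)
    (hh : IsTransition c d z h) :
    extendForm A G c z = (G d (h z)).compContinuousLinearMap (fderiv ℂ h z) :=
  Classical.epsilon_spec (p := fun η => ∀ d ∈ A, ∀ h, IsTransition c d z h →
    η = (G d (h z)).compContinuousLinearMap (fderiv ℂ h z))
    ⟨_, fun _ hd' _ hh' => hG.pullback_eq hsing hAO hA hc hz hd hd' hh hh'⟩ d hd h hh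

/-- The holomorphic volume form defined by an invariant family on the charts of an atlas. -/
noncomputable def volForm (hG : IsVolFormFamily A D G) (hsing : O.singularSet ⊆ D)
    (hAO : A ⊆ O.atlas) (hA : IsOrbAtlas A) : HolVolForm O D where
  form c := extendForm A G c
  holo c z hz := by
    obtain ⟨d, hd, h, hh⟩ := hA.exists_mem_isTransition hAO c.2 hz.1
    refine (hh.differentiableWithinAt_pullback (hG.holo d hd _ (hh.mem_diff hz.2))
      hh.tendsto_diff).congr_of_eventuallyEq ?_ (hG.extendForm_eq hsing hAO hA c.2 hz.2 hd hh)
    filter_upwards [self_mem_nhdsWithin, nhdsWithin_le_nhds hh.eventually] with w hw hhw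
      using hG.extendForm_eq hsing hAO hA c.2 hw.2 hd hhw
  ne_zero c z hz := by
    obtain ⟨d, hd, h, hh⟩ := hA.exists_mem_isTransition hAO c.2 hz.1
    rw [hG.extendForm_eq hsing hAO hA c.2 hz.2 hd hh]
    exact compContinuousLinearMap_ne_zero_of_surjective (hG.ne_zero d hd _ (hh.mem_diff hz.2))
      hh.surjective_fderiv
  invariant c c' f hf z hz := by
    have hfz := hf.isTransition hz.1
    have hz' := hfz.mem_diff hz.2
    obtain ⟨d, hd, h, hh⟩ := hA.exists_mem_isTransition hAO c'.2 hz'.1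
    rw [hG.extendForm_eq hsing hAO hA c'.2 hz'.2 hd hh,
      hG.extendForm_eq hsing hAO hA c.2 hz.2 hd (hh.comp hfz),
      fderiv_comp z hh.differentiableAt hfz.differentiableAt]
    rfl

theorem volForm_blowsUpToOrder (hG : IsVolFormFamily A D G) (hsing : O.singularSet ⊆ D)
    (hAO : A ⊆ O.atlas) (hA : IsOrbAtlas A)
    (hpole : ∀ d ∈ A, ∃ s, IsDefiningFunctionOn (d.pre D) d.U s ∧
      ∃ Ψ : CSpace (m + 1) → (CSpace (m + 1)) [⋀^Fin (m + 1)]→L[ℂ] ℂ,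
        DifferentiableOn ℂ Ψ d.U ∧ (∀ w ∈ d.U, Ψ w ≠ 0) ∧
          ∀ w ∈ d.U \ d.pre D, s w ^ α • G d w = Ψ w) :
    (hG.volForm hsing hAO hA).BlowsUpToOrder α := by
  intro c z hz
  obtain ⟨d, hd, h, hh⟩ := hA.exists_mem_isTransition hAO c.2 hz.1
  obtain ⟨s, hs, Ψ, hΨ, hΨ0, hsΨ⟩ := hpole d hd
  obtain ⟨V, hVh, hV, hzV⟩ := eventually_nhds_iff.1 hh.eventually
  refine ⟨V, fun w hw => (hVh w hw).mem_U, hV, hzV, s ∘ h,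
    IsTransition.isDefiningFunctionOn_comp hVh hs,
    fun w => (Ψ (h w)).compContinuousLinearMap (fderiv ℂ h w), fun w hw => ?_, fun w hw => ?_,
    fun w hw => ?_⟩
  · have hhw := hVh w hw
    have hΨw := hΨ.differentiableAt (d.isOpen_U.mem_nhds hhw.mem.self_of_nhds)
    exact hhw.differentiableWithinAt_pullback (T := Set.univ) hΨw.differentiableWithinAt
      (by simpa using hhw.tendsto.mono_left nhdsWithin_le_nhds)
  · exact compContinuousLinearMap_ne_zero_of_surjective (hΨ0 _ (hVh w hw).mem.self_of_nhds)
      (hVh w hw).surjective_fderiv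
  · have hhw := hVh w hw.1
    refine (congrArg (s (h w) ^ α • ·) (hG.extendForm_eq hsing hAO hA c.2 hw.2 hd hhw)).trans ?_
    exact congrArg (fun η => η.compContinuousLinearMap (fderiv ℂ h w)) (hsΨ _ (hhw.mem_diff hw.2))

end IsVolFormFamily

/-- The standard volume form `dz₁ ∧ ⋯ ∧ dzₙ`. -/
noncomputable def stdVol (n : ℕ) : (CSpace n) [⋀^Fin n]→L[ℂ] ℂ where
  toMultilinearMap := (Pi.basisFun ℂ (Fin n)).det.toMultilinearMap
  cont := by
    rw [Pi.basisFun_det]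
    exact (continuous_id (X := Fin n → Fin n → ℂ)).matrix_det
  map_eq_zero_of_eq' := (Pi.basisFun ℂ (Fin n)).det.map_eq_zero_of_eq'

theorem stdVol_ne_zero (n : ℕ) : stdVol n ≠ 0 := fun h =>
  (Pi.basisFun ℂ (Fin n)).det_ne_zero (congrArg ContinuousAlternatingMap.toAlternatingMap h)

theorem stdVol_compContinuousLinearMap {n : ℕ} (L : CSpace n →L[ℂ] CSpace n) :
    (stdVol n).compContinuousLinearMap L = L.det • stdVol n :=
  ContinuousAlternatingMap.ext fun v => (Pi.basisFun ℂ (Fin n)).det_comp L.toLinearMap v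

/-- The local volume form `θ s ^ (-α) dz₁ ∧ ⋯ ∧ dzₙ`, with a pole of order `α` along `s = 0`. -/
noncomputable def poleForm {n : ℕ} (α : ℕ) (θ s : CSpace n → ℂ) (z : CSpace n) :
    (CSpace n) [⋀^Fin n]→L[ℂ] ℂ :=
  (θ z * (s z ^ α)⁻¹) • stdVol n

/-- For `L = df`, the numbers `L.det` and `u` are the transition functions of `K_X` and `[D]`. -/
theorem poleForm_compContinuousLinearMap {n : ℕ} {θ θ' s t : CSpace n → ℂ} {z w : CSpace n}
    {L : CSpace n →L[ℂ] CSpace n} (hL : L.det ≠ 0) {u : ℂ} (hs : s z ≠ 0) (hst : s z = u * t w)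
    (hθ : θ z * L.det⁻¹ = u ^ α * θ' w) :
    (poleForm α θ' t w).compContinuousLinearMap L = poleForm α θ s z := by
  obtain ⟨hu, ht⟩ := mul_ne_zero_iff.1 (hst ▸ hs)
  have hθz : θ z = u ^ α * θ' w * L.det := by rw [← hθ, inv_mul_cancel_right₀ hL]
  calc (poleForm α θ' t w).compContinuousLinearMap L
      = (θ' w * (t w ^ α)⁻¹) • (stdVol n).compContinuousLinearMap L := rfl
    _ = poleForm α θ s z := by
      rw [stdVol_compContinuousLinearMap, smul_smul, poleForm, hθz, hst, mul_pow]
      congr 1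
      field_simp

theorem isVolFormFamily_poleForm {s θ : OrbChart X (m + 1) → CSpace (m + 1) → ℂ}
    (hs : ∀ c ∈ A, IsDefiningFunctionOn (c.pre D) c.U (s c))
    (hθ : ∀ c ∈ A, DifferentiableOn ℂ (θ c) c.U ∧ ∀ z ∈ c.U, θ c z ≠ 0)
    (htrans : ∀ c ∈ A, ∀ d ∈ A, ∀ f, IsInjection c d f →
      ∃ u, IsDivisorTransition c f (s c) (s d) u ∧
        ∀ z ∈ c.U, θ c z * ((fderiv ℂ f z).det)⁻¹ = u z ^ α * θ d (f z)) :
    IsVolFormFamily A D fun c => poleForm α (θ c) (s c) := by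
  have hs0 (c) (hc : c ∈ A) (z) (hz : z ∈ c.U \ c.pre D) : s c z ≠ 0 :=
    ((hs c hc).zero_iff z hz.1).not.2 hz.2
  refine ⟨fun c hc => ?_, fun c hc z hz => ?_, fun c hc d hd f hf z hz => ?_⟩
  · exact (((hθ c hc).1.mono Set.sdiff_subset).mul ((((hs c hc).holo.mono Set.sdiff_subset).pow
      α).inv fun z hz => pow_ne_zero _ (hs0 c hc z hz))).smul_const _
  · exact smul_ne_zero (mul_ne_zero ((hθ c hc).2 z hz.1)
      (inv_ne_zero (pow_ne_zero _ (hs0 c hc z hz)))) (stdVol_ne_zero _)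
  · obtain ⟨u, ⟨-, hu⟩, hθu⟩ := htrans c hc d hd f hf
    have hdet : (fderiv ℂ f z).det ≠ 0 := fun h0 =>
      (LinearMap.bot_lt_ker_of_det_eq_zero h0).ne' (LinearMap.ker_eq_bot.2 (hf.immersion z hz.1))
    exact poleForm_compContinuousLinearMap hdet (hs0 c hc z hz) (hu z hz.1) (hθu z hz.1)

theorem ComplexOrbifold.AnticanonicalEq.exists_blowsUpToOrder (hKD : O.AnticanonicalEq D α)
    (hsing : O.singularSet ⊆ D) : ∃ Ω : HolVolForm O D, Ω.BlowsUpToOrder α := by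
  obtain ⟨A, hAO, hA, s, hs, θ, hθ, htrans⟩ := hKD
  have hG : IsVolFormFamily A D fun c => poleForm α (θ c) (s c) :=
    isVolFormFamily_poleForm hs hθ htrans
  refine ⟨hG.volForm hsing hAO hA, hG.volForm_blowsUpToOrder hsing hAO hA fun d hd =>
    ⟨s d, hs d hd, fun w => θ d w • stdVol (m + 1), (hθ d hd).1.smul_const _,
      fun w hw => smul_ne_zero ((hθ d hd).2 w hw) (stdVol_ne_zero _), fun w hw => ?_⟩⟩
  have hsw : s d w ≠ 0 := ((hs d hd).zero_iff w hw.1).not.2 hw.2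
  rw [poleForm, smul_smul, mul_left_comm, mul_inv_cancel₀ (pow_ne_zero α hsw), mul_one]

end VolumeForms

theorem corollary2p3_general {X : Type u} [TopologicalSpace X] (m : ℕ)
    (O : ComplexOrbifold X (m + 1)) (D : Set X) (hsing : O.singularSet ⊆ D) (α : ℕ) (hα : 2 ≤ α)
    (hKD : O.AnticanonicalEq D α) (hbasic : O.BasicAssumption D α) :
    (∃ Ω : HolVolForm O D, Ω.BlowsUpToOrder α) ∧
    ∀ Ω : HolVolForm O D, Ω.BlowsUpToOrder α →
      ∃ φ : NormalToCanonMap O D,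
        φ.IsHolomorphic ∧ φ.IsUnbranchedCovering (α - 1) ∧ φ.IsResidueMap Ω α ∧
        ∀ ψ : NormalToCanonMap O D, ψ.IsResidueMap Ω α → ψ = φ := by
  refine ⟨hKD.exists_blowsUpToOrder hsing, fun Ω hΩ => ⟨residueMap hΩ, ?_, ?_, ?_, ?_⟩⟩
  · exact residueMap_isHolomorphic hΩ
  · exact residueMap_isUnbranchedCovering hΩ hα
  · exact residueMap_isResidueMap hΩ
  · exact fun ψ hψ => hψ.unique hbasic (residueMap_isResidueMap hΩ)

theorem corollary2p3 {X : Type u} [TopologicalSpace X] [CompactSpace X] [T2Space X] (m : ℕ)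
    (O : ComplexOrbifold X (m + 1)) (hK : O.IsKahler)
    (D : Set X) (hD : O.IsSuborbifoldCodimOne D) (hsing : O.singularSet ⊆ D)
    (α : ℕ) (hα : 2 ≤ α) (hKD : O.AnticanonicalEq D α) (hbasic : O.BasicAssumption D α) :
    (∃ Ω : HolVolForm O D, Ω.BlowsUpToOrder α) ∧
    ∀ Ω : HolVolForm O D, Ω.BlowsUpToOrder α →
      ∃ φ : NormalToCanonMap O D,
        φ.IsHolomorphic ∧ φ.IsUnbranchedCovering (α - 1) ∧ φ.IsResidueMap Ω α ∧
        ∀ ψ : NormalToCanonMap O D, ψ.IsResidueMap Ω α → ψ = φ :=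
  corollary2p3_general m O D hsing α hα hKD hbasic
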